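/- Let $d\ge 1$ and $\alpha>d$, and let $(\xi(z))_{z\in\mathbb{Z}^d}$ be independent random variables with $\mathrm{Prob}\{\xi(z)\le x\}=1-x^{-\alpha}$ for $x\ge 1$. Write $|z|$ for the $\ell^1$-norm on $\mathbb{Z}^d$ and let $\eta(z)$ be the logarithm of the number of nearest-neighbour paths of length $|z|$ in $\mathbb{Z}^d$ leading from $0$ to $z$. For $t>0$ and $z\in\mathbb{Z}^d$ put \[ \Phi_t(z)=\xi(z)-\frac{|z|}{t}\log\xi(z)+\frac{\eta(z)}{t}\quad\text{if } t\,\xi(z)\ge|z|,\qquad \Phi_t(z)=0\quad\text{otherwise.}\] Let $h\colon(0,\infty)\to(0,\infty)$ be nondecreasing. Then, almost surely, there is a right-continuous path $(Z_t)_{t>0}$ in $\mathbb{Z}^d$ such that $Z_t$ maximizes $\Phi_t$ for every $t>0$; and for this path, and more generally for every choice of a maximizer $Z_t$ of $\Phi_t$ for each $t>0$, the residual lifetime $R^V(t)=\sup\{s\ge 0: Z_t=Z_{t+s}\}\in[0,\infty]$ satisfies \[ \limsup_{t\to\infty}\frac{R^V(t)}{t\,h(t)}=\begin{cases}0 & \text{if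 } \displaystyle\int_1^\infty\frac{dt}{t\,h(t)^d}<\infty,\\[2mm] \infty & \text{if } \displaystyle\int_1^\infty\frac{dt}{t\,h(t)^d}=\infty.\end{cases}\] -/

import Mathlib

open MeasureTheory ProbabilityTheory Filter Topology
open scoped ENNReal NNReal

namespace PAM

/-- The sites of the integer lattice of dimension `d`. -/
abbrev Site (d : ℕ) : Type := Fin d → ℤ

/-- The `ℓ¹`-norm of a lattice site. -/
def l1norm {d : ℕ} (z : Site d) : ℕ := ∑ i, (z i).natAbs

lemma l1norm_sub_comm {d : ℕ} (x y : Site d) : l1norm (x - y) = l1norm (y - x) :=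
  Finset.sum_congr rfl fun i _ => by simp only [Pi.sub_apply]; omega

/-- The nearest-neighbour graph on the integer lattice. -/
def lattice (d : ℕ) : SimpleGraph (Site d) where
  Adj x y := l1norm (x - y) = 1
  symm := ⟨fun x y h => (l1norm_sub_comm y x).trans h⟩
  loopless := ⟨fun x h => by simp [l1norm] at h⟩

/-- The number of nearest-neighbour paths of length `|z|` leading from `0` to `z`. -/
noncomputable def pathCount {d : ℕ} (z : Site d) : ℕ :=
  {p : (lattice d).Walk 0 z | p.length = l1norm z}.ncard

/-- `η(z)`, the logarithm of the number of paths of length `|z|` leading from `0` to `z`. -/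
noncomputable def eta {d : ℕ} (z : Site d) : ℝ := Real.log (pathCount z)

open Classical in
/-- The functional `Φ_t(z)` for a potential `v` and a time `t > 0`. -/
noncomputable def Phi {d : ℕ} (v : Site d → ℝ) (t : ℝ) (z : Site d) : ℝ :=
  if (l1norm z : ℝ) ≤ t * v z then
    v z - (l1norm z : ℝ) / t * Real.log (v z) + eta z / t
  else 0

/-- `Z t` is a maximizer of `Φ_t` for every time `t > 0`. -/
def IsMaximizerPath {d : ℕ} (v : Site d → ℝ) (Z : ℝ → Site d) : Prop :=
  ∀ t : ℝ, 0 < t → ∀ y : Site d, Phi v t y ≤ Phi v t (Z t)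

/-- Right-continuity of a lattice-valued path at all positive times. -/
def IsRightContinuous {d : ℕ} (Z : ℝ → Site d) : Prop :=
  ∀ t : ℝ, 0 < t → ContinuousWithinAt Z (Set.Ici t) t

/-- The residual lifetime `sup {s ≥ 0 : Z_t = Z_{t+s}}`, with values in `[0, ∞]`. -/
noncomputable def residualLifetime {d : ℕ} (Z : ℝ → Site d) (t : ℝ) : ℝ≥0∞ :=
  ⨆ (s : ℝ≥0) (_ : Z t = Z (t + s)), (s : ℝ≥0∞)

/-- The integral `∫₁^∞ dt / (t h(t)^d)`, with values in `[0, ∞]`. -/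
noncomputable def testIntegral (d : ℕ) (h : ℝ → ℝ) : ℝ≥0∞ :=
  ∫⁻ t in Set.Ioi (1 : ℝ), ENNReal.ofReal (1 / (t * h t ^ d))

/-- `ξ` is a field of independent Pareto random variables with parameter `α`. -/
structure IsParetoField {d : ℕ} {Ω : Type*} [MeasurableSpace Ω] (P : Measure Ω) (α : ℝ)
    (ξ : Site d → Ω → ℝ) : Prop where
  measurable : ∀ z, Measurable (ξ z)
  indep : iIndepFun ξ P
  cdf : ∀ z, ∀ x : ℝ, 1 ≤ x → P {ω | ξ z ω ≤ x} = ENNReal.ofReal (1 - x ^ (-α))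

end PAM

set_option linter.unusedSectionVars false

namespace PAM

/-! ### The lattice: path counts, balls and sums -/

/-! Put κ = `pathRate d`, so that η(z) ≤ κ|z|. While a site z is active, t Φ_t(z) is affine in t
with slope ξ(z); if moreover log ξ(z) ≥ κ, then Φ_t(z) is nondecreasing and at most ξ(z). Hence,
above a fixed level, a site optimal at two times is optimal in between (`Phi_le_of_between`), and a
long residual lifetime means that a site reached early still beats all others much later.

Convergent case. If Z_t with τ ≤ t ≤ 2τ survives to time T = τθ, then some site of height about e^k,
in a ball of radius of order τe^k/k, dominates at time T. The probability of domination is never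
computed. It is compared with that of sites of height about e^(k+2), at the same threshold e^(k+1),
in a ball of radius of order τθe^k/k: these events exclude each other, so their probabilities sum to
at most 1. Domination depends on the site only up to a factor 2, the change of height costs e^(2α),
and the volume ratio is of order θ^(-d). The resulting bound C/θ^d
(`IsParetoField.exists_measure_earlyPeak_le`) is summable along τ = 2^n with θ proportional to
h(2^n), and Borel–Cantelli applies.

Divergent case. At time S_n = c n e^(n(α/d-1)) with c small, any given site of height about e^n
faces no rival above e^(n-1), with probability at least 1-δ. If the site also lies close enough to
exceed e^(n-1) at time S_n/θ, it is optimal throughout [S_n/θ, S_n]. The expected number p_n of such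
sites is at least a constant times θ^(-d); for θ = K h(S_n) + 1 these numbers have divergent sum.
Joint probabilities are at most p_n p_m, so a second-moment argument (`sub_le_measureReal_limsup`)
gives infinitely many such n with probability at least 1-2δ, and δ is arbitrary, so no zero-one law
is needed.

The right-continuous path comes from local finiteness: just after any time only finitely many sites
compete, and the set of maximizers is constant there (`eventually_rightMaximizers_eq`). -/

lemma natAbs_le_l1norm {d : ℕ} (z : Site d) (i : Fin d) : (z i).natAbs ≤ l1norm z :=
  Finset.single_le_sum (f := fun i => (z i).natAbs) (fun _ _ => Nat.zero_le _) (Finset.mem_univ i)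

/-- A walk is determined by its starting point and its steps, each of which lies in {-1,0,1}^d. This
overcounts the steps, but only a linear bound on η is needed. -/
lemma ncard_walk_length_le {d : ℕ} (u v : Site d) (n : ℕ) :
    {p : (lattice d).Walk u v | p.length = n}.ncard ≤ (3 ^ d) ^ n := by
  classical
  let U : Finset (Site d) := Fintype.piFinset fun _ => Finset.Icc (-1 : ℤ) 1
  let t : Finset (Fin n → Site d) := Fintype.piFinset fun _ => U
  have ht : t.card = (3 ^ d) ^ n := by simp [t, U]
  rw [← ht, ← Set.ncard_coe_finset]
  refine Set.ncard_le_ncard_of_injOn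
    (fun p i => p.getVert (i : ℕ) - p.getVert ((i : ℕ) + 1)) ?_ ?_
  · intro p hp
    have hp' : p.length = n := hp
    simp only [t, U, Finset.mem_coe, Fintype.mem_piFinset, Finset.mem_Icc]
    intro i j
    have h1 : l1norm (p.getVert (i : ℕ) - p.getVert ((i : ℕ) + 1)) = 1 :=
      p.adj_getVert_succ (hp' ▸ i.2)
    have h2 := natAbs_le_l1norm (p.getVert (i : ℕ) - p.getVert ((i : ℕ) + 1)) j
    omega
  · intro p hp q hq hpq
    have hp' : p.length = n := hp
    have hq' : q.length = n := hq
    have key : ∀ k, k ≤ n → p.getVert k = q.getVert k := by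
      intro k
      induction k with
      | zero => simp
      | succ k ih =>
        intro hk
        have h1 := congrFun hpq ⟨k, hk⟩
        simp only [ih (by omega)] at h1
        exact sub_right_injective h1
    refine SimpleGraph.Walk.ext_getVert fun k => ?_
    rcases le_total k n with hk | hk
    · exact key k hk
    · rw [p.getVert_of_length_le (by omega), q.getVert_of_length_le (by omega)]

/-- A bound for the growth rate of the number of lattice paths. -/
noncomputable def pathRate (d : ℕ) : ℝ := d * Real.log 3

lemma pathRate_nonneg (d : ℕ) : 0 ≤ pathRate d :=
  mul_nonneg (Nat.cast_nonneg d) (Real.log_nonneg (by norm_num))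

lemma eta_nonneg {d : ℕ} (z : Site d) : 0 ≤ eta z := Real.log_natCast_nonneg _

lemma eta_le {d : ℕ} (z : Site d) : eta z ≤ pathRate d * l1norm z := by
  rcases Nat.eq_zero_or_pos (pathCount z) with h0 | h0
  · rw [eta, h0]
    simpa using mul_nonneg (pathRate_nonneg d) (Nat.cast_nonneg _)
  · have h1 : (pathCount z : ℝ) ≤ (3 ^ d) ^ l1norm z := by
      exact_mod_cast ncard_walk_length_le 0 z (l1norm z)
    have h2 := Real.log_le_log (by exact_mod_cast h0) h1
    rw [Real.log_pow, Real.log_pow] at h2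
    rw [eta, pathRate]
    linarith

lemma finite_setOf_l1norm_le (d : ℕ) (r : ℝ) : {z : Site d | (l1norm z : ℝ) ≤ r}.Finite := by
  refine (Fintype.piFinset fun _ : Fin d => Finset.Icc (-(⌊r⌋₊ : ℤ)) ⌊r⌋₊).finite_toSet.subset ?_
  intro z hz
  have hz' : l1norm z ≤ ⌊r⌋₊ := Nat.le_floor hz
  simp only [Finset.mem_coe, Fintype.mem_piFinset, Finset.mem_Icc]
  intro i
  have := natAbs_le_l1norm z i
  omega

/-- The `ℓ¹`-ball of radius `r` about the origin. -/
noncomputable def latticeBall (d : ℕ) (r : ℝ) : Finset (Site d) :=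
  (finite_setOf_l1norm_le d r).toFinset

lemma mem_latticeBall {d : ℕ} {r : ℝ} {z : Site d} : z ∈ latticeBall d r ↔ (l1norm z : ℝ) ≤ r := by
  simp [latticeBall]

lemma card_latticeBall_le {d : ℕ} {r : ℝ} (hr : 1 ≤ r) :
    ((latticeBall d r).card : ℝ) ≤ (3 * r) ^ d := by
  have h1 : latticeBall d r ⊆ Fintype.piFinset fun _ : Fin d =>
      Finset.Icc (-(⌊r⌋₊ : ℤ)) ⌊r⌋₊ := by
    intro z hz
    have hz' : l1norm z ≤ ⌊r⌋₊ := Nat.le_floor (mem_latticeBall.1 hz)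
    simp only [Fintype.mem_piFinset, Finset.mem_Icc]
    intro i
    have := natAbs_le_l1norm z i
    omega
  have h2 := Finset.card_le_card h1
  rw [Fintype.card_piFinset_const, Int.card_Icc,
    show ((⌊r⌋₊ : ℤ) + 1 - -(⌊r⌋₊ : ℤ)).toNat = 2 * ⌊r⌋₊ + 1 by omega] at h2
  have h3 : ((latticeBall d r).card : ℝ) ≤ (2 * ⌊r⌋₊ + 1) ^ d := by exact_mod_cast h2
  refine h3.trans (pow_le_pow_left₀ (by positivity) ?_ _)
  linarith [Nat.floor_le (zero_le_one.trans hr)]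

lemma le_card_latticeBall {d : ℕ} (hd : 1 ≤ d) {r : ℝ} (hr : 0 ≤ r) :
    (r / d) ^ d ≤ ((latticeBall d r).card : ℝ) := by
  have hd0 : (0 : ℝ) < d := by exact_mod_cast hd
  have h1 : (Fintype.piFinset fun _ : Fin d => Finset.Icc (0 : ℤ) ⌊r / d⌋₊) ⊆ latticeBall d r := by
    intro z hz
    simp only [Fintype.mem_piFinset, Finset.mem_Icc] at hz
    have h2 : l1norm z ≤ d * ⌊r / d⌋₊ := by
      have : ∑ i, (z i).natAbs ≤ ∑ _i : Fin d, ⌊r / d⌋₊ :=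
        Finset.sum_le_sum fun i _ => by have := hz i; omega
      simpa [l1norm] using this
    rw [mem_latticeBall]
    have h3 : (l1norm z : ℝ) ≤ d * ⌊r / d⌋₊ := by exact_mod_cast h2
    have h4 := Nat.floor_le (div_nonneg hr hd0.le)
    calc (l1norm z : ℝ) ≤ d * (r / d) := h3.trans (by gcongr)
      _ = r := by field_simp
  have h2 := Finset.card_le_card h1
  rw [Fintype.card_piFinset_const, Int.card_Icc,
    show ((⌊r / d⌋₊ : ℤ) + 1 - 0).toNat = ⌊r / d⌋₊ + 1 by omega] at h2
  have h3 : ((⌊r / d⌋₊ : ℝ) + 1) ^ d ≤ ((latticeBall d r).card : ℝ) := by exact_mod_cast h2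
  exact le_trans (pow_le_pow_left₀ (by positivity) (Nat.lt_floor_add_one _).le _) h3

lemma tsum_pi_prod_le {d : ℕ} {ι : Type*} (f : ι → ℝ≥0∞) :
    ∑' z : Fin d → ι, ∏ i, f (z i) ≤ (∑' k, f k) ^ d := by
  classical
  rw [ENNReal.tsum_eq_iSup_sum]
  refine iSup_le fun s => ?_
  let t : Finset ι := s.biUnion fun z => Finset.univ.image z
  have hs : s ⊆ Fintype.piFinset fun _ => t := by
    intro z hz
    simp only [Fintype.mem_piFinset, t, Finset.mem_biUnion, Finset.mem_image]
    exact fun i => ⟨z, hz, i, Finset.mem_univ i, rfl⟩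
  calc ∑ z ∈ s, ∏ i, f (z i) ≤ ∑ z ∈ Fintype.piFinset fun _ : Fin d => t, ∏ i, f (z i) :=
        Finset.sum_le_sum_of_subset hs
    _ = (∑ k ∈ t, f k) ^ d := by
        rw [Finset.sum_prod_piFinset]; simp
    _ ≤ _ := by gcongr; exact ENNReal.sum_le_tsum t

lemma tsum_nat_div_comp (F : ℕ → ℝ≥0∞) (m : ℕ) [NeZero m] :
    ∑' k : ℕ, F (k / m) = m * ∑' q, F q := by
  have h1 : ∑' k : ℕ, F (k / m) = ∑' p : ℕ × Fin m, F p.1 :=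
    (Nat.divModEquiv m).tsum_eq fun p : ℕ × Fin m => F p.1
  rw [h1, ENNReal.tsum_prod', ← ENNReal.tsum_mul_left]
  simp

lemma tsum_int_natAbs_le {g : ℕ → ℝ≥0∞} (hg : ∀ k, g (k + 1) ≤ g k) :
    ∑' k : ℤ, g k.natAbs ≤ 2 * ∑' k : ℕ, g k := by
  have h1 : HasSum (fun k : ℕ => g (k : ℤ).natAbs) (∑' k : ℕ, g k) := by
    simpa using ENNReal.summable.hasSum (f := g)
  have h2 : HasSum (fun k : ℕ => g (-((k : ℤ) + 1)).natAbs) (∑' k : ℕ, g (k + 1)) := by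
    have h3 : ∀ k : ℕ, (-((k : ℤ) + 1)).natAbs = k + 1 := by omega
    simp only [h3]
    exact ENNReal.summable.hasSum
  rw [(HasSum.of_nat_of_neg_add_one (f := fun k : ℤ => g k.natAbs) h1 h2).tsum_eq, two_mul]
  gcongr with k
  exact hg k

/-- Cut the integers into blocks of length m = ⌈b/u⌉. On the q-th block b + uk ≥ b(1+q), so the sum
is at most m b^(-γ) times a convergent series. -/
lemma exists_tsum_nat_rpow_le {γ : ℝ} (hγ : 1 < γ) : ∃ C : ℝ, 0 < C ∧ ∀ b u : ℝ, 0 < b → 0 < u →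
    ∑' k : ℕ, ENNReal.ofReal ((b + u * k) ^ (-γ)) ≤ ENNReal.ofReal (C * (b ^ (-γ) * (1 + b / u))) := by
  have hs : Summable fun q : ℕ => (1 + (q : ℝ)) ^ (-γ) := by
    have := (summable_nat_add_iff 1).2 (Real.summable_nat_rpow (p := -γ).2 (by linarith))
    refine this.congr fun q => ?_
    push_cast; rw [add_comm]
  have hpos : ∀ q : ℕ, 0 ≤ (1 + (q : ℝ)) ^ (-γ) := fun q => by positivity
  refine ⟨∑' q : ℕ, (1 + (q : ℝ)) ^ (-γ), hs.tsum_pos hpos 0 (by simp), fun b u hb hu => ?_⟩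
  set m : ℕ := ⌈b / u⌉₊ with hm
  have hm0 : 0 < m := Nat.ceil_pos.2 (by positivity)
  have : NeZero m := ⟨hm0.ne'⟩
  have hm1 : b / u ≤ m := Nat.le_ceil _
  have hm2 : (m : ℝ) ≤ 1 + b / u := by linarith [Nat.ceil_lt_add_one (a := b / u) (by positivity)]
  have hterm : ∀ k : ℕ, ENNReal.ofReal ((b + u * k) ^ (-γ)) ≤
      ENNReal.ofReal (b ^ (-γ)) * ENNReal.ofReal ((1 + ((k / m : ℕ) : ℝ)) ^ (-γ)) := by
    intro k
    rw [← ENNReal.ofReal_mul (by positivity), ← Real.mul_rpow hb.le (by positivity)]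
    refine ENNReal.ofReal_le_ofReal (Real.rpow_le_rpow_of_nonpos (by positivity) ?_ (by linarith))
    have h1 : ((k / m : ℕ) : ℝ) ≤ k / m := Nat.cast_div_le
    have hm0' : (0 : ℝ) < m := by exact_mod_cast hm0
    have h2 : b ≤ m * u := (div_le_iff₀ hu).1 hm1
    have h3 : b * ((k : ℝ) / m) ≤ u * k := by
      rw [mul_div_assoc', div_le_iff₀ hm0']
      nlinarith [mul_le_mul_of_nonneg_right h2 (Nat.cast_nonneg (α := ℝ) k)]
    nlinarith [mul_le_mul_of_nonneg_left h1 hb.le]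
  calc ∑' k : ℕ, ENNReal.ofReal ((b + u * k) ^ (-γ))
      ≤ ∑' k : ℕ, ENNReal.ofReal (b ^ (-γ)) * ENNReal.ofReal ((1 + ((k / m : ℕ) : ℝ)) ^ (-γ)) :=
        ENNReal.tsum_le_tsum hterm
    _ = ENNReal.ofReal (b ^ (-γ)) * ∑' k : ℕ, ENNReal.ofReal ((1 + ((k / m : ℕ) : ℝ)) ^ (-γ)) :=
        ENNReal.tsum_mul_left
    _ = ENNReal.ofReal (b ^ (-γ)) *
        (m * ∑' q : ℕ, ENNReal.ofReal ((1 + (q : ℝ)) ^ (-γ))) := by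
        congr 1
        exact tsum_nat_div_comp (fun q : ℕ => ENNReal.ofReal ((1 + (q : ℝ)) ^ (-γ))) m
    _ ≤ _ := by
        rw [← ENNReal.ofReal_tsum_of_nonneg hpos hs, ← ENNReal.ofReal_natCast m,
          ← ENNReal.ofReal_mul (by positivity), ← ENNReal.ofReal_mul (by positivity)]
        refine ENNReal.ofReal_le_ofReal ?_
        have h0 : 0 ≤ ∑' q : ℕ, (1 + (q : ℝ)) ^ (-γ) := tsum_nonneg hpos
        have h1 : 0 ≤ b ^ (-γ) := by positivity
        calc b ^ (-γ) * (m * ∑' q : ℕ, (1 + (q : ℝ)) ^ (-γ))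
            ≤ b ^ (-γ) * ((1 + b / u) * ∑' q : ℕ, (1 + (q : ℝ)) ^ (-γ)) := by gcongr
          _ = _ := by ring

/-- Since |z| ≥ |z_i|, the power -α splits into a product of one-dimensional factors with exponent
-α/d. The one-dimensional sums converge exactly because α > d. -/
lemma exists_tsum_site_rpow_le {d : ℕ} (hd : 1 ≤ d) {α : ℝ} (hα : (d : ℝ) < α) :
    ∃ C : ℝ, 0 < C ∧ ∀ b u : ℝ, 0 < b → 0 < u →
      ∑' z : Site d, ENNReal.ofReal ((b + u * l1norm z) ^ (-α)) ≤
        ENNReal.ofReal ((C * (b ^ (-(α / d)) * (1 + b / u))) ^ d) := by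
  have hd0 : (0 : ℝ) < d := by exact_mod_cast hd
  have hγ : 1 < α / d := by rwa [one_lt_div hd0]
  obtain ⟨C, hC, H⟩ := exists_tsum_nat_rpow_le hγ
  refine ⟨2 * C, by positivity, fun b u hb hu => ?_⟩
  set g : ℕ → ℝ≥0∞ := fun k => ENNReal.ofReal ((b + u * k) ^ (-(α / d))) with hg
  have hganti : ∀ k, g (k + 1) ≤ g k := by
    intro k
    refine ENNReal.ofReal_le_ofReal (Real.rpow_le_rpow_of_nonpos (by positivity) ?_ (by linarith))
    push_cast
    nlinarith
  have hZ := tsum_int_natAbs_le hganti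
  have hprod : ∀ z : Site d, ENNReal.ofReal ((b + u * l1norm z) ^ (-α)) ≤
      ∏ i, g (z i).natAbs := by
    intro z
    rw [hg, ← ENNReal.ofReal_prod_of_nonneg (fun i _ => by positivity)]
    refine ENNReal.ofReal_le_ofReal ?_
    calc (b + u * l1norm z) ^ (-α) = ∏ _i : Fin d, (b + u * l1norm z) ^ (-(α / d)) := by
          rw [Finset.prod_const, Finset.card_univ, Fintype.card_fin,
            ← Real.rpow_mul_natCast (by positivity)]
          congr 1; field_simp
      _ ≤ _ := by
          refine Finset.prod_le_prod (fun i _ => by positivity) fun i _ =>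
            Real.rpow_le_rpow_of_nonpos (by positivity) ?_ (by linarith)
          have : ((z i).natAbs : ℝ) ≤ l1norm z := by exact_mod_cast natAbs_le_l1norm z i
          nlinarith
  calc ∑' z : Site d, ENNReal.ofReal ((b + u * l1norm z) ^ (-α))
      ≤ ∑' z : Fin d → ℤ, ∏ i, g (z i).natAbs := ENNReal.tsum_le_tsum hprod
    _ ≤ (∑' k : ℤ, g k.natAbs) ^ d := tsum_pi_prod_le fun k : ℤ => g k.natAbs
    _ ≤ (2 * ENNReal.ofReal (C * (b ^ (-(α / d)) * (1 + b / u)))) ^ d := by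
        gcongr
        exact hZ.trans (by gcongr; exact H b u hb hu)
    _ = _ := by
        rw [ENNReal.ofReal_pow (by positivity), mul_assoc 2 C, ENNReal.ofReal_mul (p := 2) (by norm_num)]
        simp

/-! ### The functional `Phi` for a fixed potential -/

section Deterministic

variable {d : ℕ} {v : Site d → ℝ} {t T b : ℝ} {x z : Site d}

/-- Above this level, `Phi` is increasing in time and bounded by the potential. -/
noncomputable def level (d : ℕ) : ℝ := Real.exp (pathRate d + 1) * (1 + pathRate d)

lemma exp_le_level (d : ℕ) : Real.exp (pathRate d + 1) ≤ level d :=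
  le_mul_of_one_le_right (Real.exp_pos _).le (by linarith [pathRate_nonneg d])

lemma level_pos (d : ℕ) : 0 < level d := (Real.exp_pos _).trans_le (exp_le_level d)

lemma Phi_of_active (h : (l1norm z : ℝ) ≤ t * v z) :
    Phi v t z = v z - (l1norm z : ℝ) / t * Real.log (v z) + eta z / t := if_pos h

lemma active_of_Phi_pos (h : 0 < Phi v t z) : (l1norm z : ℝ) ≤ t * v z := by
  by_contra h'
  rw [Phi, if_neg h'] at h
  exact h.false

lemma Phi_le_sub (ht : 0 < t) (h : (l1norm z : ℝ) ≤ t * v z) :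
    Phi v t z ≤ v z - (l1norm z : ℝ) / t * (Real.log (v z) - pathRate d) := by
  rw [Phi_of_active h]
  have h1 : eta z / t ≤ pathRate d * l1norm z / t := by gcongr; exact eta_le z
  have h2 : pathRate d * l1norm z / t = (l1norm z : ℝ) / t * pathRate d := by ring
  linarith

lemma Phi_le_of_log (ht : 0 < t) (hv : 0 < v z) (hlog : pathRate d ≤ Real.log (v z)) :
    Phi v t z ≤ v z := by
  by_cases h : (l1norm z : ℝ) ≤ t * v z
  · have h1 := Phi_le_sub ht h
    have h2 : 0 ≤ (l1norm z : ℝ) / t * (Real.log (v z) - pathRate d) :=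
      mul_nonneg (by positivity) (by linarith)
    linarith
  · rw [Phi, if_neg h]; exact hv.le

/-- An active site has |z|/t ≤ ξ(z), so the path-counting term adds at most κ ξ(z). Low sites can
therefore be ignored once the maximum exceeds `level d`. -/
lemma Phi_le_level (ht : 0 < t) (hv : 1 < v z) (hlog : Real.log (v z) ≤ pathRate d + 1) :
    Phi v t z ≤ level d := by
  have h0 := pathRate_nonneg d
  by_cases h : (l1norm z : ℝ) ≤ t * v z
  · have h1 := Phi_le_sub ht h
    have h2 : (l1norm z : ℝ) / t ≤ v z := by rw [div_le_iff₀ ht]; linarith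
    have h3 : (l1norm z : ℝ) / t * pathRate d ≤ v z * pathRate d := by gcongr
    have h4 : 0 ≤ (l1norm z : ℝ) / t * Real.log (v z) :=
      mul_nonneg (by positivity) (Real.log_nonneg hv.le)
    have h5 : v z ≤ Real.exp (pathRate d + 1) := (Real.log_le_iff_le_exp (by linarith)).1 hlog
    calc Phi v t z ≤ v z * (1 + pathRate d) := by linarith
      _ ≤ level d := mul_le_mul_of_nonneg_right h5 (by linarith)
  · rw [Phi, if_neg h]; exact (level_pos d).le

lemma Phi_le_of_le (ht : 0 < t) (hv : 1 < v z) (hb : level d ≤ b) (hvb : v z ≤ b) :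
    Phi v t z ≤ b := by
  rcases le_total (Real.log (v z)) (pathRate d + 1) with h | h
  · exact (Phi_le_level ht hv h).trans hb
  · exact (Phi_le_of_log ht (by linarith) (by linarith)).trans hvb

lemma log_of_level_lt_Phi (ht : 0 < t) (hv : 1 < v z) (h : level d < Phi v t z) :
    pathRate d + 1 < Real.log (v z) := by
  by_contra h'
  exact absurd (Phi_le_level ht hv (not_lt.1 h')) (not_le.2 h)

lemma Phi_mono (ht : 0 < t) (htT : t ≤ T) (hv : 0 < v z) (hlog : pathRate d ≤ Real.log (v z))
    (h : (l1norm z : ℝ) ≤ t * v z) : Phi v t z ≤ Phi v T z := by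
  have hT : 0 < T := ht.trans_le htT
  rw [Phi_of_active h, Phi_of_active (h.trans (by gcongr))]
  have h1 : 0 ≤ l1norm z * Real.log (v z) - eta z := by
    nlinarith [eta_le z, mul_le_mul_of_nonneg_left hlog (Nat.cast_nonneg (α := ℝ) (l1norm z))]
  have h2 : (l1norm z * Real.log (v z) - eta z) / T ≤ (l1norm z * Real.log (v z) - eta z) / t := by
    gcongr
  have h3 : ∀ s : ℝ, (l1norm z * Real.log (v z) - eta z) / s =
    (l1norm z : ℝ) / s * Real.log (v z) - eta z / s := fun s => by ring
  rw [h3, h3] at h2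
  linarith

lemma Phi_le_of_Phi_le (ht : 0 < t) (htT : t ≤ T) (hv : 1 < v z) (hb : level d ≤ b)
    (h : Phi v T z ≤ b) : Phi v t z ≤ b := by
  rcases le_total (Real.log (v z)) (pathRate d + 1) with h1 | h1
  · exact (Phi_le_level ht hv h1).trans hb
  · by_cases h2 : (l1norm z : ℝ) ≤ t * v z
    · exact (Phi_mono ht htT (by linarith) (by linarith) h2).trans h
    · rw [Phi, if_neg h2]; exact (level_pos d).le.trans hb

/-- The radius is chosen so that the penalty is at most e^(n-1), while the height exceeds e^n ≥
2e^(n-1). -/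
lemma lt_Phi_of_mem_Ioc {n : ℕ} (ht : 0 < t) (hv : v x ∈ Set.Ioc (Real.exp n) (Real.exp (n + 1)))
    (hx : (l1norm x : ℝ) ≤ t * Real.exp (n - 1) / (n + 1)) :
    Real.exp (n - 1) < Phi v t x := by
  have hn : (0 : ℝ) < n + 1 := by positivity
  have hv0 : 0 < v x := (Real.exp_pos _).trans hv.1
  have h1 : (l1norm x : ℝ) / t * (n + 1) ≤ Real.exp (n - 1) := by
    rw [le_div_iff₀ hn] at hx
    rw [div_mul_eq_mul_div, div_le_iff₀ ht]; linarith
  have h2 : 2 * Real.exp (n - 1) ≤ Real.exp n := by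
    have : Real.exp n = Real.exp (n - 1) * Real.exp 1 := by rw [← Real.exp_add]; congr 1; ring
    nlinarith [Real.exp_pos ((n : ℝ) - 1), Real.add_one_le_exp (1 : ℝ)]
  have h3 : Real.log (v x) ≤ n + 1 := (Real.log_le_iff_le_exp hv0).2 hv.2
  have hact : (l1norm x : ℝ) ≤ t * v x := by
    have h4 : (l1norm x : ℝ) / t ≤ Real.exp (n - 1) :=
      le_trans (le_mul_of_one_le_right (by positivity)
        (by linarith [Nat.cast_nonneg (α := ℝ) n])) h1
    rw [div_le_iff₀ ht] at h4
    nlinarith [hv.1, Real.exp_pos ((n : ℝ) - 1)]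
  rw [Phi_of_active hact]
  have h5 : (l1norm x : ℝ) / t * Real.log (v x) ≤ (l1norm x : ℝ) / t * (n + 1) := by gcongr
  have h6 : 0 ≤ eta x / t := div_nonneg (eta_nonneg x) ht.le
  linarith [hv.1]

/-- Turns a large value of Φ into a lower bound on the potential that grows linearly in |z|, the
form in which a union bound can be summed over the lattice. -/
lemma lt_of_lt_Phi (hT : 0 < T) (hv : 1 < v z) (hb : level d ≤ b) (h : b < Phi v T z) :
    b + (Real.log b - pathRate d) / T * l1norm z < v z := by
  have hb0 := (level_pos d).trans_le hb
  have hlog := log_of_level_lt_Phi hT hv (hb.trans_lt h)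
  have hle := Phi_le_of_log (v := v) (z := z) hT (by linarith) (by linarith)
  have h1 := Phi_le_sub hT (active_of_Phi_pos (hb0.trans h))
  have h2 : Real.log b ≤ Real.log (v z) := Real.log_le_log hb0 (by linarith)
  have h3 : (l1norm z : ℝ) / T * (Real.log b - pathRate d) ≤
    (l1norm z : ℝ) / T * (Real.log (v z) - pathRate d) := by gcongr
  have h4 : (Real.log b - pathRate d) / T * l1norm z =
    (l1norm z : ℝ) / T * (Real.log b - pathRate d) := by ring
  linarith

lemma Phi_zero_pos (hv : ∀ z, 1 < v z) (ht : 0 < t) : 0 < Phi v t (0 : Site d) := by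
  have h0 : l1norm (0 : Site d) = 0 := by simp [l1norm]
  have h1 : (l1norm (0 : Site d) : ℝ) ≤ t * v 0 := by
    rw [h0]; have := hv 0; push_cast; positivity
  rw [Phi_of_active h1, h0]
  have h2 : 0 ≤ eta (0 : Site d) / t := div_nonneg (eta_nonneg _) ht.le
  have := hv 0
  simp only [Nat.cast_zero, zero_div, zero_mul, sub_zero]
  linarith

lemma mul_Phi (ht : 0 < t) (h : (l1norm z : ℝ) ≤ t * v z) :
    t * Phi v t z = t * v z - (l1norm z * Real.log (v z) - eta z) := by
  rw [Phi_of_active h]; field_simp; ring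

/-- A site that is optimal at two large times is optimal at all times in between. -/
lemma Phi_le_of_between {t' : ℝ} (hv : ∀ z, 1 < v z) (ht : 0 < t) (htT : t ≤ T) (hTt : T ≤ t')
    (hlev : level d < Phi v t x) (hmax : ∀ z, Phi v t z ≤ Phi v t x)
    (hmax' : ∀ z, Phi v t' z ≤ Phi v t' x) (z : Site d) : Phi v T z ≤ Phi v T x := by
  have hT : 0 < T := ht.trans_le htT
  have ht' : 0 < t' := hT.trans_le hTt
  have hx0 : 0 < v x := by linarith [hv x]
  have hz0 : 0 < v z := by linarith [hv z]
  have hxlog := log_of_level_lt_Phi ht (hv x) hlev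
  have hxt := active_of_Phi_pos ((level_pos d).trans hlev)
  have hxT : (l1norm x : ℝ) ≤ T * v x := hxt.trans (by gcongr)
  have hxt' : (l1norm x : ℝ) ≤ t' * v x := hxT.trans (by gcongr)
  have hxTlev : level d < Phi v T x := hlev.trans_le (Phi_mono ht htT hx0 (by linarith) hxt)
  rcases le_total (Real.log (v z)) (pathRate d + 1) with hz | hz
  · exact (Phi_le_level hT (hv z) hz).trans hxTlev.le
  by_cases hzT : (l1norm z : ℝ) ≤ T * v z
  swap
  · rw [Phi, if_neg hzT]; exact ((level_pos d).trans hxTlev).le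
  have hzt' : (l1norm z : ℝ) ≤ t' * v z := hzT.trans (by gcongr)
  have e1 := mul_Phi ht hxt
  have e2 := mul_Phi ht' hxt'
  have e3 := mul_Phi hT hxT
  have e4 := mul_Phi hT hzT
  have e5 := mul_Phi ht' hzt'
  have h1 : t * v z - (l1norm z * Real.log (v z) - eta z) ≤
      t * v x - (l1norm x * Real.log (v x) - eta x) := by
    by_cases hzt : (l1norm z : ℝ) ≤ t * v z
    · rw [← mul_Phi ht hzt, ← e1]
      exact mul_le_mul_of_nonneg_left (hmax z) ht.le
    -- When z is inactive at time t, Φ does not follow its affine formula. But log ξ(z) ≥ κ + 1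
    -- makes the subtracted term at least |z| > t ξ(z), so the affine extension is negative and the
    -- comparison still holds.
    · have h2 : 0 ≤ t * Phi v t x := mul_nonneg ht.le ((level_pos d).trans hlev).le
      have h3 : (l1norm z : ℝ) * (pathRate d + 1) ≤ l1norm z * Real.log (v z) := by gcongr
      have h4 := eta_le z
      push Not at hzt
      linarith
  have h2 : t' * v z - (l1norm z * Real.log (v z) - eta z) ≤
      t' * v x - (l1norm x * Real.log (v x) - eta x) := by
    rw [← e2, ← e5]
    exact mul_le_mul_of_nonneg_left (hmax' z) ht'.le
  have h3 : T * Phi v T z ≤ T * Phi v T x := by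
    rw [e3, e4]
    -- The difference of the two affine functions is monotone: by the sign of its slope, the
    -- inequality carries forward from t or back from t'.
    by_cases hc : v z ≤ v x
    · nlinarith
    · nlinarith
  exact le_of_mul_le_mul_left h3 hT

lemma eventually_exists_lt_Phi (hv : ∀ M : ℝ, ∃ z, M < v z) (M : ℝ) :
    ∀ᶠ t in atTop, ∃ z : Site d, M < Phi v t z := by
  obtain ⟨z, hz⟩ := hv (max M 0)
  have hz0 : 0 < v z := (le_max_right _ _).trans_lt hz
  have hlim : Tendsto (fun t : ℝ => v z - (l1norm z * Real.log (v z) - eta z) / t) atTop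
      (𝓝 (v z - 0)) :=
    tendsto_const_nhds.sub (tendsto_const_nhds.div_atTop tendsto_id)
  rw [sub_zero] at hlim
  filter_upwards [hlim.eventually_const_lt ((le_max_left _ _).trans_lt hz), eventually_gt_atTop 0,
    eventually_ge_atTop (l1norm z / v z)] with t ht ht0 ht1
  refine ⟨z, ?_⟩
  rw [Phi_of_active ((div_le_iff₀ hz0).1 ht1)]
  have : (l1norm z * Real.log (v z) - eta z) / t = (l1norm z : ℝ) / t * Real.log (v z) - eta z / t := by
    ring
  linarith

end Deterministic

/-! ### A right-continuous choice of maximizers -/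

section RightContinuous

variable {d : ℕ} {v : Site d → ℝ} {t : ℝ}

lemma exists_mul_Phi_eq_affine (hv : ∀ z, 1 < v z) (ht : 0 < t) (z : Site d) :
    ∃ p q : ℝ, ∀ᶠ s in 𝓝[≥] t, s * Phi v s z = p * s + q := by
  have hz : 0 < v z := by linarith [hv z]
  by_cases h : (l1norm z : ℝ) ≤ t * v z
  · refine ⟨v z, -(l1norm z * Real.log (v z) - eta z), ?_⟩
    filter_upwards [self_mem_nhdsWithin] with s hs
    have hs' : t ≤ s := hs
    rw [mul_Phi (ht.trans_le hs') (h.trans (by gcongr))]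
    ring
  · refine ⟨0, 0, ?_⟩
    have h1 : ∀ᶠ s in 𝓝[≥] t, s * v z < l1norm z :=
      ((continuous_id.mul continuous_const).tendsto t |>.eventually_lt_const
        (not_le.1 h)).filter_mono nhdsWithin_le_nhds
    filter_upwards [h1] with s hs
    rw [Phi, if_neg (not_le.2 hs)]
    ring

lemma continuousWithinAt_Phi (hv : ∀ z, 1 < v z) (ht : 0 < t) (z : Site d) :
    ContinuousWithinAt (fun s => Phi v s z) (Set.Ici t) t := by
  obtain ⟨p, q, h⟩ := exists_mul_Phi_eq_affine hv ht z
  have h1 : (fun s => Phi v s z) =ᶠ[𝓝[≥] t] fun s => (p * s + q) / s := by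
    filter_upwards [h, self_mem_nhdsWithin] with s hs hst
    have hs0 : s ≠ 0 := (ht.trans_le hst).ne'
    rw [← hs]; field_simp
  refine ContinuousWithinAt.congr_of_eventuallyEq ?_ h1 (h1.self_of_nhdsWithin Set.self_mem_Ici)
  exact ContinuousAt.continuousWithinAt
    (by fun_prop (disch := exact ht.ne'))

lemma eventually_affine_sign (p q t : ℝ) :
    (∀ᶠ s in 𝓝[>] t, 0 ≤ p * s + q) ∨ ∀ᶠ s in 𝓝[>] t, p * s + q < 0 := by
  have hc : Tendsto (fun s => p * s + q) (𝓝[>] t) (𝓝 (p * t + q)) :=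
    (Continuous.tendsto (by fun_prop) t).mono_left nhdsWithin_le_nhds
  rcases lt_trichotomy (p * t + q) 0 with h | h | h
  · exact Or.inr (hc.eventually_lt_const h)
  · rcases le_or_gt 0 p with hp | hp
    · left
      filter_upwards [self_mem_nhdsWithin] with s hs
      have hs' : t < s := hs
      nlinarith
    · right
      filter_upwards [self_mem_nhdsWithin] with s hs
      have hs' : t < s := hs
      nlinarith
  · exact Or.inl ((hc.eventually_const_lt h).mono fun _ => le_of_lt)

/-- Multiplied by time, both values are affine just to the right of t, so their order cannot
oscillate there. -/
lemma eventually_Phi_le_or_lt (hv : ∀ z, 1 < v z) (ht : 0 < t) (y z : Site d) :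
    (∀ᶠ s in 𝓝[>] t, Phi v s y ≤ Phi v s z) ∨ ∀ᶠ s in 𝓝[>] t, Phi v s z < Phi v s y := by
  have hle : 𝓝[>] t ≤ 𝓝[≥] t := nhdsWithin_mono t Set.Ioi_subset_Ici_self
  obtain ⟨p, q, h⟩ := exists_mul_Phi_eq_affine hv ht z
  obtain ⟨p', q', h'⟩ := exists_mul_Phi_eq_affine hv ht y
  refine (eventually_affine_sign (p - p') (q - q') t).imp (fun hs => ?_) fun hs => ?_
  · filter_upwards [hs, hle h, hle h', self_mem_nhdsWithin] with s hs h1 h2 h3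
    have h3' : 0 < s := ht.trans h3
    refine le_of_mul_le_mul_left ?_ h3'
    rw [h1, h2]; linarith
  · filter_upwards [hs, hle h, hle h', self_mem_nhdsWithin] with s hs h1 h2 h3
    have h3' : 0 < s := ht.trans h3
    refine lt_of_mul_lt_mul_left ?_ h3'.le
    rw [h1, h2]; linarith

lemma active_of_isMax (hv : ∀ z, 1 < v z) (ht : 0 < t) {z : Site d}
    (hz : ∀ y, Phi v t y ≤ Phi v t z) : (l1norm z : ℝ) ≤ t * v z :=
  active_of_Phi_pos ((Phi_zero_pos hv ht).trans_le (hz 0))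

lemma exists_isMax (hv : ∀ z, 1 < v z) (hfin : {z : Site d | (l1norm z : ℝ) ≤ t * v z}.Finite)
    (ht : 0 < t) : ∃ z, ∀ y, Phi v t y ≤ Phi v t z := by
  have hpos := Phi_zero_pos hv ht
  obtain ⟨z, hz, hmax⟩ := hfin.exists_maximalFor (fun z => Phi v t z) _
    ⟨0, active_of_Phi_pos hpos⟩
  have hmax' : ∀ y, (l1norm y : ℝ) ≤ t * v y → Phi v t y ≤ Phi v t z := fun y hy =>
    (le_total (Phi v t y) (Phi v t z)).elim id fun h => hmax hy h
  refine ⟨z, fun y => ?_⟩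
  by_cases hy : (l1norm y : ℝ) ≤ t * v y
  · exact hmax' y hy
  · have := hpos.le.trans (hmax' 0 (active_of_Phi_pos hpos))
    rwa [Phi, if_neg hy]

lemma eventually_isMax_or_not (hv : ∀ z, 1 < v z)
    (hfin : ∀ t : ℝ, {z : Site d | (l1norm z : ℝ) ≤ t * v z}.Finite) (ht : 0 < t) (z : Site d) :
    (∀ᶠ s in 𝓝[>] t, ∀ y, Phi v s y ≤ Phi v s z) ∨
      ∀ᶠ s in 𝓝[>] t, ¬ ∀ y, Phi v s y ≤ Phi v s z := by
  have hlt : ∀ᶠ s in 𝓝[>] t, s < t + 1 :=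
    (eventually_lt_nhds (by linarith : t < t + 1)).filter_mono nhdsWithin_le_nhds
  by_cases h : ∃ y, ∀ᶠ s in 𝓝[>] t, Phi v s z < Phi v s y
  · obtain ⟨y, hy⟩ := h
    exact Or.inr (hy.mono fun s hs hmax => (hmax y).not_gt hs)
  · have h := not_exists.1 h
    left
    have h1 : ∀ᶠ s in 𝓝[>] t, ∀ y ∈ {z : Site d | (l1norm z : ℝ) ≤ (t + 1) * v z},
        Phi v s y ≤ Phi v s z :=
      (hfin (t + 1)).eventually_all.2 fun y _ =>
        (eventually_Phi_le_or_lt hv ht y z).resolve_right fun hy => h y hy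
    filter_upwards [h1, hlt, self_mem_nhdsWithin] with s hs hst hts
    have hs0 : 0 < s := ht.trans hts
    obtain ⟨w, hw⟩ := exists_isMax hv (hfin s) hs0
    have hw' : (l1norm w : ℝ) ≤ (t + 1) * v w :=
      (active_of_isMax hv hs0 hw).trans
        (mul_le_mul_of_nonneg_right hst.le (by linarith [hv w]))
    -- Some maximizer w exists at time s and is active at time t + 1, so beating the finitely many
    -- sites active then is enough.
    exact fun y => (hw y).trans (hs w hw')

/-- The sites that maximize `Phi` immediately after time `t`. -/
def rightMaximizers (v : Site d → ℝ) (t : ℝ) : Set (Site d) :=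
  {z | ∀ᶠ s in 𝓝[>] t, ∀ y, Phi v s y ≤ Phi v s z}

lemma rightMaximizers_nonempty (hv : ∀ z, 1 < v z)
    (hfin : ∀ t : ℝ, {z : Site d | (l1norm z : ℝ) ≤ t * v z}.Finite) (ht : 0 < t) :
    (rightMaximizers v t).Nonempty := by
  by_contra hne
  have hlt : ∀ᶠ s in 𝓝[>] t, s < t + 1 :=
    (eventually_lt_nhds (by linarith : t < t + 1)).filter_mono nhdsWithin_le_nhds
  have h1 : ∀ᶠ s in 𝓝[>] t, ∀ z ∈ {z : Site d | (l1norm z : ℝ) ≤ (t + 1) * v z},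
      ¬ ∀ y, Phi v s y ≤ Phi v s z :=
    (hfin (t + 1)).eventually_all.2 fun z _ =>
      (eventually_isMax_or_not hv hfin ht z).resolve_left fun hz => hne ⟨z, hz⟩
  obtain ⟨s, hs, hst, hts⟩ := (h1.and (hlt.and self_mem_nhdsWithin)).exists
  have hs0 : 0 < s := ht.trans hts
  obtain ⟨w, hw⟩ := exists_isMax hv (hfin s) hs0
  exact hs w ((active_of_isMax hv hs0 hw).trans
    (mul_le_mul_of_nonneg_right hst.le (by linarith [hv w]))) hw

lemma isMax_of_mem_rightMaximizers (hv : ∀ z, 1 < v z) (ht : 0 < t) {z : Site d}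
    (hz : z ∈ rightMaximizers v t) (y : Site d) : Phi v t y ≤ Phi v t z := by
  have hle : 𝓝[>] t ≤ 𝓝[≥] t := nhdsWithin_mono t Set.Ioi_subset_Ici_self
  have hz' : ∀ᶠ s in 𝓝[>] t, ∀ y, Phi v s y ≤ Phi v s z := hz
  have hy : Tendsto (fun s => Phi v s y) (𝓝[>] t) (𝓝 (Phi v t y)) :=
    (continuousWithinAt_Phi hv ht y).mono_left hle
  have hz : Tendsto (fun s => Phi v s z) (𝓝[>] t) (𝓝 (Phi v t z)) :=
    (continuousWithinAt_Phi hv ht z).mono_left hle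
  exact le_of_tendsto_of_tendsto hy hz (hz'.mono fun s hs => hs y)

lemma eventually_rightMaximizers_eq (hv : ∀ z, 1 < v z)
    (hfin : ∀ t : ℝ, {z : Site d | (l1norm z : ℝ) ≤ t * v z}.Finite) (ht : 0 < t) :
    ∀ᶠ s in 𝓝[>] t, rightMaximizers v s = rightMaximizers v t := by
  have hlt : ∀ᶠ s in 𝓝[>] t, s < t + 1 :=
    (eventually_lt_nhds (by linarith : t < t + 1)).filter_mono nhdsWithin_le_nhds
  have hee : ∀ p : ℝ → Prop, (∀ᶠ s in 𝓝[>] t, p s) → ∀ᶠ s in 𝓝[>] t, ∀ᶠ r in 𝓝[>] s, p r := by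
    intro p hp
    filter_upwards [eventually_eventually_nhdsWithin.2 hp, self_mem_nhdsWithin] with s hs hts
    exact hs.filter_mono (nhdsWithin_mono s (Set.Ioi_subset_Ioi (le_of_lt hts)))
  have hact : ∀ s, 0 < s → s < t + 1 → ∀ z ∈ rightMaximizers v s,
      (l1norm z : ℝ) ≤ (t + 1) * v z := fun s hs hst z hz =>
    (active_of_isMax hv hs (isMax_of_mem_rightMaximizers hv hs hz)).trans
        (mul_le_mul_of_nonneg_right hst.le (by linarith [hv z]))
  have h1 : ∀ᶠ s in 𝓝[>] t, ∀ z ∈ {z : Site d | (l1norm z : ℝ) ≤ (t + 1) * v z},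
      (z ∈ rightMaximizers v s ↔ z ∈ rightMaximizers v t) := by
    refine (hfin (t + 1)).eventually_all.2 fun z _ => ?_
    rcases eventually_isMax_or_not hv hfin ht z with hz | hz
    · filter_upwards [hee _ hz] with s hs
      exact iff_of_true hs hz
    · filter_upwards [hee _ hz] with s hs
      refine iff_of_false (fun h => ?_) fun h => ?_
      · obtain ⟨r, hr, hr'⟩ := (hs.and h).exists
        exact hr hr'
      · obtain ⟨r, hr, hr'⟩ := (hz.and h).exists
        exact hr hr'
  filter_upwards [h1, hlt, self_mem_nhdsWithin] with s hs hst hts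
  ext z
  exact ⟨fun h => (hs z (hact s (ht.trans hts) hst z h)).1 h,
    fun h => (hs z (hact t ht (by linarith) z h)).2 h⟩

-- The choice is made as a function of the set of right maximizers alone. That set is locally
-- constant to the right, so the path is too.
open Classical in
lemma exists_rightContinuous_maximizerPath (hv : ∀ z, 1 < v z)
    (hfin : ∀ t : ℝ, {z : Site d | (l1norm z : ℝ) ≤ t * v z}.Finite) :
    ∃ Z : ℝ → Site d, IsMaximizerPath v Z ∧ IsRightContinuous Z := by
  let c : Set (Site d) → Site d := fun S => if h : S.Nonempty then h.choose else 0
  have hc : ∀ S : Set (Site d), S.Nonempty → c S ∈ S := fun S h => by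
    simp only [c, dif_pos h]; exact h.choose_spec
  refine ⟨fun t => c (rightMaximizers v t), fun t ht => ?_, fun t ht => ?_⟩
  · exact isMax_of_mem_rightMaximizers hv ht (hc _ (rightMaximizers_nonempty hv hfin ht))
  · have h1 : (fun s => c (rightMaximizers v s)) =ᶠ[𝓝[≥] t] fun _ => c (rightMaximizers v t) := by
      rw [← Set.Ioi_insert, EventuallyEq, nhdsWithin_insert, eventually_sup]
      refine ⟨rfl, ?_⟩
      filter_upwards [eventually_rightMaximizers_eq hv hfin ht] with s hs
      rw [hs]
    exact continuousWithinAt_const.congr_of_eventuallyEq h1 rfl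

end RightContinuous

/-! ### A second-moment Borel–Cantelli lemma -/

section SecondMoment

variable {Ω : Type*} [MeasurableSpace Ω] {P : Measure Ω} [IsProbabilityMeasure P]
  {E : ℕ → Set Ω} {p : ℕ → ℝ} {δ : ℝ}

/-- With X the number of events that occur and S the sum of the p n, (S - X)² ≥ 0 gives 2SX - X² ≤
S² on the union, and X = 0 off it. Taking expectations yields the bound; the diagonal terms of E X²
account for 1/S. -/
lemma sub_le_measureReal_biUnion (hE : ∀ n, MeasurableSet (E n))
    (h1 : ∀ n, (1 - δ) * p n ≤ P.real (E n)) (h2 : ∀ n, P.real (E n) ≤ p n)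
    (h3 : ∀ n m, n ≠ m → P.real (E n ∩ E m) ≤ p n * p m) (s : Finset ℕ)
    (hS : 0 < ∑ n ∈ s, p n) :
    1 - 2 * δ - (∑ n ∈ s, p n)⁻¹ ≤ P.real (⋃ n ∈ s, E n) := by
  classical
  set S := ∑ n ∈ s, p n with hSdef
  set U := ⋃ n ∈ s, E n with hU
  have hUm : MeasurableSet U := s.measurableSet_biUnion fun n _ => hE n
  have hint : ∀ A : Set Ω, MeasurableSet A → Integrable (A.indicator fun _ => (1 : ℝ)) P :=
    fun A hA => (integrable_const 1).indicator hA
  have hval : ∀ A : Set Ω, MeasurableSet A → ∫ ω, A.indicator (fun _ => (1 : ℝ)) ω ∂P = P.real A :=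
    fun A hA => integral_indicator_one hA
  have hpt : ∀ ω, (2 * S * ∑ n ∈ s, (E n).indicator (fun _ => (1 : ℝ)) ω) -
      ∑ n ∈ s, ∑ m ∈ s, (E n ∩ E m).indicator (fun _ => (1 : ℝ)) ω ≤
      S ^ 2 * U.indicator (fun _ => (1 : ℝ)) ω := by
    intro ω
    have hsq : ∑ n ∈ s, ∑ m ∈ s, (E n ∩ E m).indicator (fun _ => (1 : ℝ)) ω =
        (∑ n ∈ s, (E n).indicator (fun _ => (1 : ℝ)) ω) ^ 2 := by
      rw [sq, Finset.sum_mul_sum]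
      refine Finset.sum_congr rfl fun n _ => Finset.sum_congr rfl fun m _ => ?_
      by_cases hn : ω ∈ E n <;> by_cases hm : ω ∈ E m <;> simp [hn, hm]
    rw [hsq]
    by_cases hω : ω ∈ U
    · rw [Set.indicator_of_mem hω]
      nlinarith [sq_nonneg (S - ∑ n ∈ s, (E n).indicator (fun _ => (1 : ℝ)) ω)]
    · have h0 : ∑ n ∈ s, (E n).indicator (fun _ => (1 : ℝ)) ω = 0 :=
        Finset.sum_eq_zero fun n hn => Set.indicator_of_notMem
          (fun h => hω (Set.mem_biUnion hn h)) _
      rw [h0, Set.indicator_of_notMem hω]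
      simp
  have hi1 : Integrable (fun ω => 2 * S * ∑ n ∈ s, (E n).indicator (fun _ => (1 : ℝ)) ω) P :=
    (integrable_finsetSum s fun n _ => hint _ (hE n)).const_mul _
  have hi2 : Integrable (fun ω => ∑ n ∈ s, ∑ m ∈ s,
      (E n ∩ E m).indicator (fun _ => (1 : ℝ)) ω) P :=
    integrable_finsetSum s fun n _ => integrable_finsetSum s fun m _ =>
      hint _ ((hE n).inter (hE m))
  have key := integral_mono (hi1.sub hi2) ((hint U hUm).const_mul (S ^ 2)) hpt
  simp only [Pi.sub_apply] at key
  rw [integral_sub hi1 hi2, integral_const_mul, integral_const_mul, hval U hUm,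
    integral_finsetSum s fun n _ => hint _ (hE n),
    integral_finsetSum s fun n _ => integrable_finsetSum s fun m _ =>
      hint _ ((hE n).inter (hE m)),
    Finset.sum_congr rfl fun n _ => hval _ (hE n),
    Finset.sum_congr rfl fun n _ => (integral_finsetSum s fun m _ =>
      hint _ ((hE n).inter (hE m))).trans
        (Finset.sum_congr rfl fun m _ => hval _ ((hE n).inter (hE m)))] at key
  have hlow : (1 - δ) * S ≤ ∑ n ∈ s, P.real (E n) := by
    rw [hSdef, Finset.mul_sum]
    exact Finset.sum_le_sum fun n _ => h1 n
  have hp0 : ∀ n, 0 ≤ p n := fun n => measureReal_nonneg.trans (h2 n)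
  have hup : ∑ n ∈ s, ∑ m ∈ s, P.real (E n ∩ E m) ≤ S ^ 2 + S := by
    calc ∑ n ∈ s, ∑ m ∈ s, P.real (E n ∩ E m)
        ≤ ∑ n ∈ s, ∑ m ∈ s, (p n * p m + if n = m then p n else 0) := by
          refine Finset.sum_le_sum fun n _ => Finset.sum_le_sum fun m _ => ?_
          rcases eq_or_ne n m with rfl | hnm
          · rw [Set.inter_self, if_pos rfl]
            nlinarith [h2 n, mul_self_nonneg (p n)]
          · rw [if_neg hnm, add_zero]; exact h3 n m hnm
      _ = S ^ 2 + S := by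
          simp_rw [Finset.sum_add_distrib, Finset.sum_ite_eq]
          rw [← Finset.sum_mul_sum, sq]
          congr 1
          exact Finset.sum_congr rfl fun n hn => if_pos hn
  have hfin : 2 * S * ((1 - δ) * S) - (S ^ 2 + S) ≤ S ^ 2 * P.real U := by
    have := mul_le_mul_of_nonneg_left hlow (by positivity : 0 ≤ 2 * S)
    linarith
  have hS2 : 0 < S ^ 2 := by positivity
  refine le_of_mul_le_mul_left ?_ hS2
  have : S ^ 2 * (1 - 2 * δ - S⁻¹) = 2 * S * ((1 - δ) * S) - (S ^ 2 + S) := by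
    field_simp; ring
  linarith

lemma sub_le_measureReal_limsup (hE : ∀ n, MeasurableSet (E n))
    (h1 : ∀ n, (1 - δ) * p n ≤ P.real (E n)) (h2 : ∀ n, P.real (E n) ≤ p n)
    (h3 : ∀ n m, n ≠ m → P.real (E n ∩ E m) ≤ p n * p m) (hS : ¬ Summable p) :
    1 - 2 * δ ≤ P.real (limsup E atTop) := by
  have hp0 : ∀ n, 0 ≤ p n := fun n => measureReal_nonneg.trans (h2 n)
  have hlim : limsup E atTop = ⋂ k, ⋃ n, ⋃ (_ : n ≥ k), E n := by
    simp only [limsup_eq_iInf_iSup_of_nat, Set.iInf_eq_iInter, Set.iSup_eq_iUnion]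
  have hUm : ∀ k, MeasurableSet (⋃ n, ⋃ (_ : n ≥ k), E n) := fun k =>
    MeasurableSet.iUnion fun n => MeasurableSet.iUnion fun _ => hE n
  have hanti : Antitone fun k => ⋃ n, ⋃ (_ : n ≥ k), E n := fun k l hkl =>
    Set.iUnion_mono fun n => Set.iUnion_subset fun hn =>
      Set.subset_iUnion (fun _ : n ≥ k => E n) (hkl.trans hn)
  have hk : ∀ k, 1 - 2 * δ ≤ P.real (⋃ n, ⋃ (_ : n ≥ k), E n) := by
    intro k
    have hT : Tendsto (fun N => ∑ n ∈ Finset.range N, p n) atTop atTop :=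
      (not_summable_iff_tendsto_nat_atTop_of_nonneg hp0).1 hS
    have hT' : Tendsto (fun N => ∑ n ∈ Finset.Ico k N, p n) atTop atTop := by
      refine (tendsto_atTop_add_const_right atTop (-∑ n ∈ Finset.range k, p n) hT).congr' ?_
      filter_upwards [eventually_ge_atTop k] with N hN
      rw [Finset.sum_Ico_eq_sub _ hN]; ring
    have hlim' : Tendsto (fun N => 1 - 2 * δ - (∑ n ∈ Finset.Ico k N, p n)⁻¹) atTop
        (𝓝 (1 - 2 * δ - 0)) := tendsto_const_nhds.sub hT'.inv_tendsto_atTop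
    rw [sub_zero] at hlim'
    refine le_of_tendsto hlim' ?_
    filter_upwards [hT'.eventually_gt_atTop 0] with N hN
    refine (sub_le_measureReal_biUnion hE h1 h2 h3 _ hN).trans (measureReal_mono ?_ (measure_ne_top _ _))
    exact Set.iUnion_mono fun n => Set.iUnion_subset fun hn =>
      Set.subset_iUnion (fun _ : n ≥ k => E n) (Finset.mem_Ico.1 hn).1
  rw [hlim]
  have ht := tendsto_measure_iInter_atTop (μ := P) (fun k => (hUm k).nullMeasurableSet) hanti
    ⟨0, measure_ne_top _ _⟩
  exact ge_of_tendsto ((ENNReal.tendsto_toReal (measure_ne_top _ _)).comp ht)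
    (Eventually.of_forall hk)

end SecondMoment

/-! ### Pareto fields -/

lemma measurable_Phi_const {d : ℕ} (T : ℝ) (z : Site d) :
    Measurable fun y : ℝ => Phi (fun _ => y) T z := by
  unfold Phi
  refine Measurable.ite (measurableSet_le (by fun_prop) (by fun_prop)) ?_ measurable_const
  have := Real.measurable_log
  fun_prop

/-! ### Isolated peaks and their mutual exclusion -/

section Peaks

variable {d : ℕ} {Ω : Type*} {ξ : Site d → Ω → ℝ} {T : ℝ}

/-- No site other than `x` has a value of `Phi` exceeding `b` at time `T`. -/
def dominated (ξ : Site d → Ω → ℝ) (T b : ℝ) (x : Site d) : Set Ω :=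
  {ω | ∀ z, z ≠ x → Phi (fun z => ξ z ω) T z ≤ b}

/-- The potential at `x` lies in `(eⁿ, eⁿ⁺¹]` and all other sites are dominated. -/
def isolatedPeak (ξ : Site d → Ω → ℝ) (T b : ℝ) (n : ℕ) (x : Site d) : Set Ω :=
  ξ x ⁻¹' Set.Ioc (Real.exp n) (Real.exp (n + 1)) ∩ dominated ξ T b x

/-- Within the appropriate ball, the isolated peaks of all heights are mutually exclusive. -/
lemma isolatedPeak_unique {ω : Ω} {b : ℕ → ℝ} (hT : 0 < T) {n m : ℕ} {x y : Site d}
    (hbn : b n ≤ Real.exp (n - 1)) (hbm : b m ≤ Real.exp (m - 1))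
    (hx : (l1norm x : ℝ) ≤ T * Real.exp (n - 1) / (n + 1))
    (hy : (l1norm y : ℝ) ≤ T * Real.exp (m - 1) / (m + 1))
    (hωx : ω ∈ isolatedPeak ξ T (b n) n x) (hωy : ω ∈ isolatedPeak ξ T (b m) m y) :
    n = m ∧ x = y := by
  have h1 := lt_Phi_of_mem_Ioc (v := fun z => ξ z ω) hT hωx.1 hx
  have h2 := lt_Phi_of_mem_Ioc (v := fun z => ξ z ω) hT hωy.1 hy
  have hxy : x = y := by
    by_contra hne
    have h3 := hωx.2 y (Ne.symm hne)
    have h4 := hωy.2 x hne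
    linarith
  subst hxy
  refine ⟨?_, rfl⟩
  have h3 : Real.exp n < Real.exp (m + 1) := hωx.1.1.trans_le hωy.1.2
  have h4 : Real.exp m < Real.exp (n + 1) := hωy.1.1.trans_le hωx.1.2
  rw [Real.exp_lt_exp] at h3 h4
  norm_cast at h3 h4
  omega

end Peaks

/-! ### Tail bounds, independence and domination probabilities -/

section ParetoField

variable {d : ℕ} {Ω : Type*} [MeasurableSpace Ω] {P : Measure Ω} [IsProbabilityMeasure P]
  {α : ℝ} {ξ : Site d → Ω → ℝ} {T b : ℝ}

lemma IsParetoField.measure_lt (hξ : IsParetoField P α ξ) (hα : 0 < α) (z : Site d) {x : ℝ}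
    (hx : 1 ≤ x) : P {ω | x < ξ z ω} = ENNReal.ofReal (x ^ (-α)) := by
  have h1 : {ω | x < ξ z ω} = {ω | ξ z ω ≤ x}ᶜ := by ext; simp
  have h2 : x ^ (-α) ≤ 1 := Real.rpow_le_one_of_one_le_of_nonpos hx (by linarith)
  rw [h1, prob_compl_eq_one_sub (measurableSet_le (hξ.measurable z) measurable_const),
    hξ.cdf z x hx, ← ENNReal.ofReal_one, ← ENNReal.ofReal_sub _ (by linarith)]
  congr 1; ring

lemma IsParetoField.measure_lt_le (hξ : IsParetoField P α ξ) (hα : 0 < α) (z : Site d) {x : ℝ}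
    (hx : 0 < x) : P {ω | x < ξ z ω} ≤ ENNReal.ofReal (x ^ (-α)) := by
  rcases le_total 1 x with h | h
  · exact (hξ.measure_lt hα z h).le
  · refine prob_le_one.trans ?_
    rw [← ENNReal.ofReal_one]
    exact ENNReal.ofReal_le_ofReal (Real.one_le_rpow_of_pos_of_le_one_of_nonpos hx h (by linarith))

/-- The probability that a Pareto variable lies in `(1, e]`. -/
noncomputable def paretoUnit (α : ℝ) : ℝ := 1 - Real.exp (-α)

lemma paretoUnit_pos (hα : 0 < α) : 0 < paretoUnit α := by
  have : Real.exp (-α) < 1 := Real.exp_lt_one_iff.mpr (by linarith)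
  unfold paretoUnit; linarith

lemma IsParetoField.measure_Ioc_exp (hξ : IsParetoField P α ξ) (hα : 0 < α) (z : Site d) (n : ℕ) :
    P (ξ z ⁻¹' Set.Ioc (Real.exp n) (Real.exp (n + 1))) =
      ENNReal.ofReal (paretoUnit α * Real.exp (-α * n)) := by
  have h1 : ξ z ⁻¹' Set.Ioc (Real.exp n) (Real.exp (n + 1)) =
      {ω | Real.exp n < ξ z ω} \ {ω | Real.exp (n + 1) < ξ z ω} := by
    ext; simp
  have hn : (0 : ℝ) ≤ n := Nat.cast_nonneg n
  have h2 : Real.exp n ≤ Real.exp (n + 1) := Real.exp_le_exp.2 (by linarith)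
  have hsub : {ω | Real.exp (n + 1) < ξ z ω} ⊆ {ω | Real.exp n < ξ z ω} :=
    fun ω hω => h2.trans_lt hω
  rw [h1, measure_sdiff hsub
      (measurableSet_lt measurable_const (hξ.measurable z)).nullMeasurableSet (measure_ne_top _ _),
    hξ.measure_lt hα z (Real.one_le_exp hn), hξ.measure_lt hα z (Real.one_le_exp (by linarith)),
    ← ENNReal.ofReal_sub _ (by positivity), ← Real.exp_mul, ← Real.exp_mul, paretoUnit, sub_mul,
    ← Real.exp_add]
  congr 3 <;> ring_nf

lemma IsParetoField.ae_one_lt (hξ : IsParetoField P α ξ) :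
    ∀ᵐ ω ∂P, ∀ z, 1 < ξ z ω := by
  refine ae_all_iff.2 fun z => ?_
  rw [ae_iff]
  have := hξ.cdf z 1 le_rfl
  simpa using this

lemma IsParetoField.measure_inter_iInter (hξ : IsParetoField P α ξ) (x : Site d) {A : Set ℝ}
    (hA : MeasurableSet A) {B : Site d → Set ℝ} (hB : ∀ z, MeasurableSet (B z)) :
    P (ξ x ⁻¹' A ∩ {ω | ∀ z, z ≠ x → ξ z ω ∈ B z}) =
      P (ξ x ⁻¹' A) * P {ω | ∀ z, z ≠ x → ξ z ω ∈ B z} := by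
  have hind := indep_iSup_of_disjoint (fun z => (hξ.measurable z).comap_le) hξ.indep.iIndep
    (S := {x}) (T := {x}ᶜ) disjoint_compl_right
  refine (Indep_iff _ _ _).1 hind _ _ ?_ ?_
  · have : MeasurableSpace.comap (ξ x) inferInstance ≤
        ⨆ i ∈ ({x} : Set (Site d)), MeasurableSpace.comap (ξ i) inferInstance :=
      le_iSup₂_of_le x rfl le_rfl
    exact this _ ⟨A, hA, rfl⟩
  · have h1 : {ω | ∀ z, z ≠ x → ξ z ω ∈ B z} = ⋂ z, ⋂ (_ : z ≠ x), ξ z ⁻¹' B z := by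
      ext; simp
    rw [h1]
    refine MeasurableSet.iInter fun z => MeasurableSet.iInter fun hz => ?_
    have : MeasurableSpace.comap (ξ z) inferInstance ≤
        ⨆ i ∈ ({x}ᶜ : Set (Site d)), MeasurableSpace.comap (ξ i) inferInstance :=
      le_iSup₂_of_le z hz le_rfl
    exact this _ ⟨B z, hB z, rfl⟩

lemma IsParetoField.measure_inter_preimage (hξ : IsParetoField P α ξ) {x y : Site d} (hxy : x ≠ y)
    {A B : Set ℝ} (hA : MeasurableSet A) (hB : MeasurableSet B) :
    P (ξ x ⁻¹' A ∩ ξ y ⁻¹' B) = P (ξ x ⁻¹' A) * P (ξ y ⁻¹' B) :=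
  (hξ.indep.indepFun hxy).measure_inter_preimage_eq_mul _ _ hA hB

lemma IsParetoField.ae_exists_lt (hd : 1 ≤ d) (hξ : IsParetoField P α ξ) :
    ∀ᵐ ω ∂P, ∀ M : ℝ, ∃ z, M < ξ z ω := by
  have hk : ∀ k : ℕ, ∀ᵐ ω ∂P, ∃ z, (k : ℝ) < ξ z ω := by
    intro k
    set x : ℝ := k + 1 with hx
    have hx1 : 1 ≤ x := by have := Nat.cast_nonneg (α := ℝ) k; linarith
    have hq : 0 < x ^ (-α) := by positivity
    set q : ℝ≥0∞ := ENNReal.ofReal (1 - x ^ (-α)) with hqdef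
    have hq1 : q < 1 := by
      rw [hqdef, ← ENNReal.ofReal_one]
      exact (ENNReal.ofReal_lt_ofReal_iff one_pos).2 (by linarith)
    have hbound : ∀ n : ℕ, P {ω | ∀ z, ξ z ω ≤ x} ≤ q ^ n := by
      intro n
      -- Diagonal sites supply arbitrarily many independent copies; injectivity is where d ≥ 1
      -- enters.
      have hinj : Function.Injective fun i : ℕ => (fun _ => (i : ℤ) : Site d) := by
        intro i j hij
        have h := congrFun hij ⟨0, hd⟩
        simpa using h
      let s : Finset (Site d) := (Finset.range n).map ⟨_, hinj⟩
      have hs : s.card = n := by simp [s]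
      have h1 := hξ.indep.measure_inter_preimage_eq_mul s
        (sets := fun _ => Set.Iic x) (fun _ _ => measurableSet_Iic)
      have h2 : ∀ z, P (ξ z ⁻¹' Set.Iic x) = q := fun z => hξ.cdf z x hx1
      rw [Finset.prod_congr rfl fun z _ => h2 z, Finset.prod_const, hs] at h1
      rw [← h1]
      refine measure_mono fun ω hω => ?_
      simp only [Set.mem_iInter]
      exact fun z _ => hω z
    have h0 : P {ω | ∀ z, ξ z ω ≤ x} = 0 :=
      le_antisymm (ge_of_tendsto (ENNReal.tendsto_pow_atTop_nhds_zero_of_lt_one hq1)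
        (Eventually.of_forall hbound)) zero_le
    rw [ae_iff]
    refine measure_mono_null (fun ω hω => ?_) h0
    intro z
    by_contra h
    exact hω ⟨z, by linarith⟩
  filter_upwards [ae_all_iff.2 hk] with ω hω M
  obtain ⟨k, hk⟩ := exists_nat_ge M
  obtain ⟨z, hz⟩ := hω k
  exact ⟨z, hk.trans_lt hz⟩

/-- Borel–Cantelli with linearly growing thresholds. The offset 1/2 keeps the threshold positive at
the origin and is paid for by ξ > 1. -/
lemma IsParetoField.ae_finite_active (hd : 1 ≤ d) (hα : (d : ℝ) < α) (hξ : IsParetoField P α ξ) :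
    ∀ᵐ ω ∂P, ∀ t : ℝ, {z : Site d | (l1norm z : ℝ) ≤ t * ξ z ω}.Finite := by
  have hα0 : 0 < α := (Nat.cast_nonneg d).trans_lt hα
  obtain ⟨C, -, hC⟩ := exists_tsum_site_rpow_le hd hα
  have hk : ∀ k : ℕ, ∀ᵐ ω ∂P,
      {z : Site d | 1 / 2 + 1 / (2 * ((k : ℝ) + 1)) * l1norm z < ξ z ω}.Finite := by
    intro k
    refine ae_finite_setOfPred_mem
      (s := fun z : Site d => {ω | 1 / 2 + 1 / (2 * ((k : ℝ) + 1)) * l1norm z < ξ z ω}) ?_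
    refine ne_top_of_le_ne_top ENNReal.ofReal_ne_top (le_trans (ENNReal.tsum_le_tsum fun z => ?_)
      (hC (1 / 2) (1 / (2 * ((k : ℝ) + 1))) (by norm_num) (by positivity)))
    exact hξ.measure_lt_le hα0 z (by positivity)
  filter_upwards [ae_all_iff.2 hk, hξ.ae_one_lt] with ω hω hω1 t
  obtain ⟨k, hk⟩ := exists_nat_ge t
  refine (hω k).subset fun z hz => ?_
  have hz' : (l1norm z : ℝ) ≤ t * ξ z ω := hz
  have h1 := hω1 z
  have h2 : (l1norm z : ℝ) < (k + 1) * ξ z ω := hz'.trans_lt (by gcongr; linarith)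
  change 1 / 2 + 1 / (2 * ((k : ℝ) + 1)) * l1norm z < ξ z ω
  have h3 : 1 / (2 * ((k : ℝ) + 1)) * l1norm z < ξ z ω / 2 := by
    rw [div_mul_eq_mul_div, one_mul, div_lt_div_iff₀ (by positivity) (by norm_num)]
    linarith
  linarith

lemma measurableSet_Phi_const_le (T b : ℝ) (z : Site d) :
    MeasurableSet {y : ℝ | Phi (fun _ => y) T z ≤ b} :=
  measurableSet_le (measurable_Phi_const T z) measurable_const

lemma IsParetoField.measurableSet_Phi_le (hξ : IsParetoField P α ξ) (T b : ℝ) (z : Site d) :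
    MeasurableSet {ω | Phi (fun z => ξ z ω) T z ≤ b} :=
  hξ.measurable z (measurableSet_Phi_const_le T b z)

lemma IsParetoField.measurableSet_dominated (hξ : IsParetoField P α ξ) (T b : ℝ) (x : Site d) :
    MeasurableSet (dominated ξ T b x) := by
  have h1 : dominated ξ T b x =
      ⋂ z, ⋂ (_ : z ≠ x), {ω | Phi (fun z => ξ z ω) T z ≤ b} := by
    ext; simp [dominated]
  rw [h1]
  exact MeasurableSet.iInter fun z => MeasurableSet.iInter fun _ => hξ.measurableSet_Phi_le T b z

lemma IsParetoField.measurableSet_isolatedPeak (hξ : IsParetoField P α ξ) (T b : ℝ) (n : ℕ)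
    (x : Site d) : MeasurableSet (isolatedPeak ξ T b n x) :=
  (hξ.measurable x measurableSet_Ioc).inter (hξ.measurableSet_dominated T b x)

lemma IsParetoField.measure_inter_dominated (hξ : IsParetoField P α ξ) (x : Site d) {A : Set ℝ}
    (hA : MeasurableSet A) :
    P (ξ x ⁻¹' A ∩ dominated ξ T b x) = P (ξ x ⁻¹' A) * P (dominated ξ T b x) :=
  hξ.measure_inter_iInter x hA fun z => measurableSet_Phi_const_le T b z

lemma IsParetoField.measure_isolatedPeak (hξ : IsParetoField P α ξ) (hα : 0 < α) (n : ℕ)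
    (x : Site d) : P (isolatedPeak ξ T b n x) =
      ENNReal.ofReal (paretoUnit α * Real.exp (-α * n)) * P (dominated ξ T b x) := by
  rw [isolatedPeak, hξ.measure_inter_dominated x measurableSet_Ioc, hξ.measure_Ioc_exp hα]

lemma measure_Phi_le_le_dominated (x : Site d) :
    P {ω | ∀ z, Phi (fun z => ξ z ω) T z ≤ b} ≤ P (dominated ξ T b x) :=
  measure_mono fun _ hω z _ => hω z

/-- The event that ξ(x) ≤ b is independent of domination and has probability at least 1/2, and
together they keep all of Φ below b. So the domination probability is independent of x up to a
factor 2. -/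
lemma IsParetoField.measure_dominated_le (hξ : IsParetoField P α ξ) (hα : 1 ≤ α) (hT : 0 < T)
    (hb : level d ≤ b) (hb' : Real.exp 1 ≤ b) (x : Site d) :
    P (dominated ξ T b x) ≤ 2 * P {ω | ∀ z, Phi (fun z => ξ z ω) T z ≤ b} := by
  have hb1 : 1 ≤ b := by linarith [Real.add_one_le_exp (1 : ℝ)]
  have h1 : P (ξ x ⁻¹' Set.Iic b ∩ dominated ξ T b x) ≤
      P {ω | ∀ z, Phi (fun z => ξ z ω) T z ≤ b} := by
    refine measure_mono_ae ?_
    filter_upwards [hξ.ae_one_lt] with ω hω1 hω z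
    rcases eq_or_ne z x with rfl | hz
    · exact Phi_le_of_le hT (hω1 z) hb hω.1
    · exact hω.2 z hz
  rw [hξ.measure_inter_dominated x measurableSet_Iic] at h1
  have h2 : ENNReal.ofReal (1 / 2) ≤ P (ξ x ⁻¹' Set.Iic b) := by
    have : P (ξ x ⁻¹' Set.Iic b) = ENNReal.ofReal (1 - b ^ (-α)) := hξ.cdf x b hb1
    rw [this]
    refine ENNReal.ofReal_le_ofReal ?_
    have h3 : b ^ (-α) ≤ b ^ (-1 : ℝ) := Real.rpow_le_rpow_of_exponent_le hb1 (by linarith)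
    rw [Real.rpow_neg_one] at h3
    have h4 : b⁻¹ ≤ 2⁻¹ := by
      gcongr; linarith [Real.add_one_le_exp (1 : ℝ)]
    linarith
  calc P (dominated ξ T b x) = 2 * (ENNReal.ofReal (1 / 2) * P (dominated ξ T b x)) := by
        rw [← mul_assoc, ← ENNReal.ofReal_ofNat 2, ← ENNReal.ofReal_mul (by norm_num)]
        norm_num
    _ ≤ 2 * (P (ξ x ⁻¹' Set.Iic b) * P (dominated ξ T b x)) := by gcongr
    _ ≤ _ := by gcongr

lemma IsParetoField.measure_compl_dominated_le (hξ : IsParetoField P α ξ) (hα : 0 < α)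
    (hT : 0 < T) (hb : level d ≤ b) (x : Site d) :
    P (dominated ξ T b x)ᶜ ≤
      ∑' z : Site d, ENNReal.ofReal ((b + (Real.log b - pathRate d) / T * l1norm z) ^ (-α)) := by
  have hb0 := (level_pos d).trans_le hb
  have hlog : pathRate d + 1 ≤ Real.log b :=
    (Real.le_log_iff_exp_le hb0).2 ((exp_le_level d).trans hb)
  have h1 : P (dominated ξ T b x)ᶜ ≤
      P (⋃ z, {ω | b + (Real.log b - pathRate d) / T * l1norm z < ξ z ω}) := by
    refine measure_mono_ae ?_
    filter_upwards [hξ.ae_one_lt] with ω hω1 hω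
    have hω' : ¬ ∀ z, z ≠ x → Phi (fun z => ξ z ω) T z ≤ b := hω
    push Not at hω'
    obtain ⟨z, -, hz⟩ := hω'
    exact Set.mem_iUnion.2 ⟨z, lt_of_lt_Phi (v := fun z => ξ z ω) hT (hω1 z) hb hz⟩
  refine h1.trans ((measure_iUnion_le _).trans (ENNReal.tsum_le_tsum fun z => ?_))
  refine hξ.measure_lt_le hα z (add_pos_of_pos_of_nonneg hb0 ?_)
  exact mul_nonneg (div_nonneg (by linarith) hT.le) (Nat.cast_nonneg _)

end ParetoField

/-! ### The probability that an early optimal site persists -/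

section EarlyPeak

/-- Heights `e^k` with `k` at least this number exceed `level d`. -/
noncomputable def startHeight (d : ℕ) : ℕ := ⌈level d⌉₊

lemma pathRate_add_one_le_startHeight (d : ℕ) : pathRate d + 1 ≤ startHeight d := by
  have h1 := Nat.le_ceil (level d)
  have h2 := exp_le_level d
  have h3 := Real.add_one_le_exp (pathRate d + 1)
  unfold startHeight
  linarith

lemma level_le_exp {d k : ℕ} (hk : startHeight d ≤ k) : level d ≤ Real.exp k := by
  have h1 := Nat.le_ceil (level d)
  have h2 : (startHeight d : ℝ) ≤ k := by exact_mod_cast hk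
  have h3 := Real.add_one_le_exp (k : ℝ)
  unfold startHeight at h2
  linarith

variable {d : ℕ} {Ω : Type*} {ξ : Site d → Ω → ℝ} {τ T : ℝ}

/-- Some site that can be optimal before time `2τ` is optimal, up to a factor, at time `T`. -/
def earlyPeak (ξ : Site d → Ω → ℝ) (τ T : ℝ) : Set Ω :=
  ⋃ k : ℕ, ⋃ (_ : startHeight d ≤ k),
    ⋃ x ∈ latticeBall d (2 * τ * Real.exp (k + 1) / (k - pathRate d)),
      isolatedPeak ξ T (Real.exp (k + 1)) k x

lemma mem_earlyPeak {ω : Ω} {v : Site d → ℝ} (hv : v = fun z => ξ z ω) {x : Site d}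
    (hlev : (startHeight d : ℝ) + 1 < Real.log (v x)) (hv0 : 0 < v x)
    (hx : (l1norm x : ℝ) * (Real.log (v x) - pathRate d) ≤ 2 * τ * v x) (hτ : 0 ≤ τ)
    (hmax : ∀ z, Phi v T z ≤ v x) : ω ∈ earlyPeak ξ τ T := by
  subst hv
  dsimp only at *
  set l := Real.log (ξ x ω) with hl
  -- A ceiling minus one, not a floor: the height classes (e^k, e^(k+1)] are open on the left.
  set k : ℕ := ⌈l⌉₊ - 1 with hk
  have hκ := pathRate_nonneg d
  have hsh := pathRate_add_one_le_startHeight d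
  have hc : 1 ≤ ⌈l⌉₊ := Nat.one_le_ceil_iff.2 (by linarith)
  have hk1 : (k : ℝ) + 1 = ⌈l⌉₊ := by
    rw [hk]; push_cast [Nat.cast_sub hc]; ring
  have hkl : (k : ℝ) < l := by
    have := Nat.ceil_lt_add_one (a := l) (by linarith)
    linarith
  have hlk : l ≤ k + 1 := by rw [hk1]; exact Nat.le_ceil _
  have hsk : startHeight d ≤ k := by
    have : (startHeight d : ℝ) < k := by linarith
    exact_mod_cast this.le
  have hsk' : (startHeight d : ℝ) ≤ k := by exact_mod_cast hsk
  have hv1 : Real.exp k < ξ x ω := (Real.lt_log_iff_exp_lt hv0).1 hkl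
  have hv2 : ξ x ω ≤ Real.exp (k + 1) := (Real.log_le_iff_le_exp hv0).1 hlk
  refine Set.mem_iUnion.2 ⟨k, Set.mem_iUnion.2 ⟨hsk, Set.mem_biUnion (x := x) ?_ ⟨⟨hv1, hv2⟩, ?_⟩⟩⟩
  · refine mem_latticeBall.2 ?_
    rw [le_div_iff₀ (by linarith)]
    calc (l1norm x : ℝ) * (k - pathRate d) ≤ l1norm x * (l - pathRate d) := by gcongr
      _ ≤ 2 * τ * ξ x ω := hx
      _ ≤ _ := by gcongr
  · exact fun z _ => (hmax z).trans hv2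

lemma card_latticeBall_le_mul (hd : 1 ≤ d) {θ : ℝ} (hτ : 1 ≤ τ) (hθ : 0 < θ) {k : ℕ}
    (hk : startHeight d ≤ k) :
    ((latticeBall d (2 * τ * Real.exp (k + 1) / (k - pathRate d))).card : ℝ) ≤
      (6 * d * (4 + pathRate d) / θ) ^ d *
        (latticeBall d (τ * θ * Real.exp (k + 1) / (k + 3))).card := by
  have hκ := pathRate_nonneg d
  have hsh := pathRate_add_one_le_startHeight d
  have hk' : (startHeight d : ℝ) ≤ k := by exact_mod_cast hk
  have hkκ : 1 ≤ k - pathRate d := by linarith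
  have hd0 : (0 : ℝ) < d := by exact_mod_cast hd
  have hr : 1 ≤ 2 * τ * Real.exp (k + 1) / (k - pathRate d) := by
    rw [one_le_div (by linarith)]
    nlinarith [Real.add_one_le_exp ((k : ℝ) + 1), Real.exp_pos ((k : ℝ) + 1)]
  refine (card_latticeBall_le hr).trans ?_
  refine le_trans ?_ (mul_le_mul_of_nonneg_left (le_card_latticeBall hd (by positivity))
    (by positivity))
  rw [← mul_pow]
  refine pow_le_pow_left₀ (by positivity) ?_ _
  -- With j = k - κ ≥ 1 this reads j + κ + 3 ≤ (4 + κ)j; the bound j ≥ 1 is why heights begin at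
  -- `startHeight d`.
  have h1 : (k : ℝ) + 3 ≤ (4 + pathRate d) * (k - pathRate d) := by nlinarith
  have h2 : 6 * d * (4 + pathRate d) / θ * (τ * θ * Real.exp (k + 1) / (k + 3) / d) =
      6 * τ * Real.exp (k + 1) * ((4 + pathRate d) / (k + 3)) := by
    field_simp
  have h3 : 3 * (2 * τ * Real.exp (k + 1) / (k - pathRate d)) =
      6 * τ * Real.exp (k + 1) * (1 / (k - pathRate d)) := by ring
  rw [h2, h3]
  refine mul_le_mul_of_nonneg_left ?_ (by positivity)
  rw [div_le_div_iff₀ (by linarith) (by positivity)]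
  linarith

variable [MeasurableSpace Ω] {P : Measure Ω} [IsProbabilityMeasure P] {α : ℝ}

/-- Raising the height index to k + 2 makes the threshold e^(k+1) one unit below the peak, as
`isolatedPeak_unique` requires. All the events are then disjoint, across sites and heights. -/
lemma IsParetoField.tsum_measure_isolatedPeak_le_one (hξ : IsParetoField P α ξ) (hT : 0 < T) :
    ∑' k : ℕ, ∑ x ∈ latticeBall d (T * Real.exp (k + 1) / (k + 3)),
      P (isolatedPeak ξ T (Real.exp (k + 1)) (k + 2) x) ≤ 1 := by
  have huniq : ∀ k l : ℕ, ∀ x ∈ latticeBall d (T * Real.exp (k + 1) / (k + 3)),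
      ∀ y ∈ latticeBall d (T * Real.exp (l + 1) / (l + 3)), ∀ ω,
      ω ∈ isolatedPeak ξ T (Real.exp (k + 1)) (k + 2) x →
      ω ∈ isolatedPeak ξ T (Real.exp (l + 1)) (l + 2) y → k = l ∧ x = y := by
    intro k l x hx y hy ω hωx hωy
    rw [mem_latticeBall] at hx hy
    have e : ∀ k : ℕ, ((k + 2 : ℕ) : ℝ) - 1 = k + 1 := fun k => by push_cast; ring
    have e' : ∀ k : ℕ, ((k + 2 : ℕ) : ℝ) + 1 = k + 3 := fun k => by push_cast; ring
    have := isolatedPeak_unique (b := fun n => Real.exp (n - 1)) hT (n := k + 2) (m := l + 2)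
      le_rfl le_rfl (by rwa [e, e']) (by rwa [e, e']) (by rwa [e]) (by rwa [e])
    exact ⟨by omega, this.2⟩
  have hm : ∀ k : ℕ, ∀ x, MeasurableSet (isolatedPeak ξ T (Real.exp (k + 1)) (k + 2) x) :=
    fun k x => hξ.measurableSet_isolatedPeak _ _ _ _
  have h1 : ∀ k : ℕ, ∑ x ∈ latticeBall d (T * Real.exp (k + 1) / (k + 3)),
      P (isolatedPeak ξ T (Real.exp (k + 1)) (k + 2) x) =
      P (⋃ x ∈ latticeBall d (T * Real.exp (k + 1) / (k + 3)),
        isolatedPeak ξ T (Real.exp (k + 1)) (k + 2) x) := by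
    intro k
    refine (measure_biUnion_finset (fun x hx y hy hxy => ?_) fun x _ => hm k x).symm
    exact Set.disjoint_left.2 fun ω h h' => hxy (huniq k k x hx y hy ω h h').2
  simp_rw [h1]
  rw [← measure_iUnion]
  · exact prob_le_one
  · intro k l hkl
    refine Set.disjoint_left.2 fun ω h h' => ?_
    simp only [Set.mem_iUnion] at h h'
    obtain ⟨x, hx, hωx⟩ := h
    obtain ⟨y, hy, hωy⟩ := h'
    exact hkl (huniq k l x hx y hy ω hωx hωy).1
  · exact fun k => Finset.measurableSet_biUnion _ fun x _ => hm k x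

lemma IsParetoField.exists_measure_earlyPeak_le (hd : 1 ≤ d) (hα : (d : ℝ) < α)
    (hξ : IsParetoField P α ξ) : ∃ C : ℝ, 0 < C ∧ ∀ τ θ : ℝ, 1 ≤ τ → 0 < θ →
      P (earlyPeak ξ τ (τ * θ)) ≤ ENNReal.ofReal (C / θ ^ d) := by
  have hd1 : (1 : ℝ) ≤ d := by exact_mod_cast hd
  have hα1 : 1 ≤ α := hd1.trans hα.le
  have hα0 : 0 < α := by linarith
  have hκ := pathRate_nonneg d
  have hs := paretoUnit_pos hα0
  refine ⟨2 * Real.exp (2 * α) * (6 * d * (4 + pathRate d)) ^ d, by positivity,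
    fun τ θ hτ hθ => ?_⟩
  set A : ℝ := 6 * d * (4 + pathRate d) / θ with hA
  have hA0 : 0 < A := by positivity
  have hC : 2 * Real.exp (2 * α) * (6 * d * (4 + pathRate d)) ^ d / θ ^ d =
      2 * Real.exp (2 * α) * A ^ d := by rw [hA, div_pow]; ring
  set T := τ * θ with hT
  have hT0 : 0 < T := by positivity
  have hk : ∀ k : ℕ, startHeight d ≤ k →
      P (⋃ x ∈ latticeBall d (2 * τ * Real.exp (k + 1) / (k - pathRate d)),
        isolatedPeak ξ T (Real.exp (k + 1)) k x) ≤
      ENNReal.ofReal (2 * Real.exp (2 * α) * A ^ d) *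
        ∑ x ∈ latticeBall d (T * Real.exp (k + 1) / (k + 3)),
          P (isolatedPeak ξ T (Real.exp (k + 1)) (k + 2) x) := by
    intro k hk
    have hlev : level d ≤ Real.exp (k + 1) :=
      (level_le_exp hk).trans (Real.exp_le_exp.2 (by linarith))
    have he : Real.exp 1 ≤ Real.exp (k + 1) :=
      Real.exp_le_exp.2 (by linarith [Nat.cast_nonneg (α := ℝ) k])
    set q := P {ω | ∀ z, Phi (fun z => ξ z ω) T z ≤ Real.exp (k + 1)} with hq
    set N := (latticeBall d (2 * τ * Real.exp (k + 1) / (k - pathRate d))).card with hN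
    set N' := (latticeBall d (T * Real.exp (k + 1) / (k + 3))).card with hN'
    have hcard : (N : ℝ) ≤ A ^ d * N' := card_latticeBall_le_mul hd hτ hθ hk
    have hup : P (⋃ x ∈ latticeBall d (2 * τ * Real.exp (k + 1) / (k - pathRate d)),
        isolatedPeak ξ T (Real.exp (k + 1)) k x) ≤
        N * (ENNReal.ofReal (paretoUnit α * Real.exp (-α * k)) * (2 * q)) := by
      refine (measure_biUnion_finset_le _ _).trans ?_
      rw [← nsmul_eq_mul]
      refine Finset.sum_le_card_nsmul _ _ _ fun x _ => ?_
      rw [hξ.measure_isolatedPeak hα0]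
      gcongr
      exact hξ.measure_dominated_le hα1 hT0 hlev he x
    have hlow : N' * (ENNReal.ofReal (paretoUnit α * Real.exp (-α * (k + 2 : ℕ))) * q) ≤
        ∑ x ∈ latticeBall d (T * Real.exp (k + 1) / (k + 3)),
          P (isolatedPeak ξ T (Real.exp (k + 1)) (k + 2) x) := by
      rw [← nsmul_eq_mul]
      refine Finset.card_nsmul_le_sum _ _ _ fun x _ => ?_
      rw [hξ.measure_isolatedPeak hα0]
      gcongr
      exact measure_Phi_le_le_dominated x
    -- Both bounds contain the same unknown q, which cancels; only the ratios of volumes and of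
    -- Pareto weights remain.
    refine hup.trans (le_trans ?_ (mul_le_mul_right hlow _))
    have e1 : (N : ℝ≥0∞) * (ENNReal.ofReal (paretoUnit α * Real.exp (-α * k)) * (2 * q)) =
        ENNReal.ofReal (N * (paretoUnit α * Real.exp (-α * k)) * 2) * q := by
      rw [ENNReal.ofReal_mul (q := 2) (by positivity),
        ENNReal.ofReal_mul (p := (N : ℝ)) (by positivity), ENNReal.ofReal_natCast, ENNReal.ofReal_ofNat]
      ring
    have e2 : ENNReal.ofReal (2 * Real.exp (2 * α) * A ^ d) *
        (N' * (ENNReal.ofReal (paretoUnit α * Real.exp (-α * (k + 2 : ℕ))) * q)) =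
        ENNReal.ofReal (2 * Real.exp (2 * α) * A ^ d *
          (N' * (paretoUnit α * Real.exp (-α * (k + 2 : ℕ))))) * q := by
      rw [ENNReal.ofReal_mul (p := 2 * Real.exp (2 * α) * A ^ d) (by positivity),
        ENNReal.ofReal_mul (p := (N' : ℝ)) (by positivity), ENNReal.ofReal_natCast]
      ring
    rw [e1, e2]
    gcongr ENNReal.ofReal ?_ * q
    have e3 : Real.exp (-α * k) = Real.exp (2 * α) * Real.exp (-α * (k + 2 : ℕ)) := by
      rw [← Real.exp_add]; congr 1; push_cast; ring
    rw [e3]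
    calc N * (paretoUnit α * (Real.exp (2 * α) * Real.exp (-α * (k + 2 : ℕ)))) * 2
        ≤ (A ^ d * N') * (paretoUnit α * (Real.exp (2 * α) * Real.exp (-α * (k + 2 : ℕ)))) * 2 := by
          gcongr
      _ = _ := by ring
  rw [hC]
  calc P (earlyPeak ξ τ T)
      ≤ ∑' k : ℕ, P (⋃ (_ : startHeight d ≤ k),
          ⋃ x ∈ latticeBall d (2 * τ * Real.exp (k + 1) / (k - pathRate d)),
          isolatedPeak ξ T (Real.exp (k + 1)) k x) := measure_iUnion_le _
    _ ≤ ∑' k : ℕ, ENNReal.ofReal (2 * Real.exp (2 * α) * A ^ d) *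
        ∑ x ∈ latticeBall d (T * Real.exp (k + 1) / (k + 3)),
          P (isolatedPeak ξ T (Real.exp (k + 1)) (k + 2) x) := by
        refine ENNReal.tsum_le_tsum fun k => ?_
        by_cases h : startHeight d ≤ k
        · simpa only [h, Set.iUnion_true] using hk k h
        · simp [h]
    _ ≤ ENNReal.ofReal (2 * Real.exp (2 * α) * A ^ d) * 1 := by
        rw [ENNReal.tsum_mul_left]
        gcongr
        exact hξ.tsum_measure_isolatedPeak_le_one hT0
    _ = _ := mul_one _

end EarlyPeak

/-! ### Convergent test integrals -/

section Convergent

variable {d : ℕ} {h : ℝ → ℝ}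

lemma tsum_ne_top_of_testIntegral_lt_top (hpos : ∀ t : ℝ, 0 < t → 0 < h t)
    (hmono : MonotoneOn h (Set.Ioi 0)) (hint : testIntegral d h < ∞) :
    ∑' n : ℕ, ENNReal.ofReal (1 / h (2 ^ n) ^ d) ≠ ∞ := by
  have h2 : ∀ n : ℕ, (0 : ℝ) < 2 ^ n := fun n => by positivity
  have hn : ∀ n : ℕ, ENNReal.ofReal (1 / h (2 ^ (n + 1)) ^ d) ≤
      2 * ∫⁻ t in Set.Ioc ((2 : ℝ) ^ n) (2 ^ (n + 1)), ENNReal.ofReal (1 / (t * h t ^ d)) := by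
    intro n
    have hh : 0 < h (2 ^ (n + 1)) := hpos _ (h2 _)
    have h1 : ∫⁻ _ in Set.Ioc ((2 : ℝ) ^ n) (2 ^ (n + 1)),
        ENNReal.ofReal (1 / (2 ^ (n + 1) * h (2 ^ (n + 1)) ^ d)) ≤
        ∫⁻ t in Set.Ioc ((2 : ℝ) ^ n) (2 ^ (n + 1)), ENNReal.ofReal (1 / (t * h t ^ d)) := by
      refine setLIntegral_mono' measurableSet_Ioc fun t ht => ENNReal.ofReal_le_ofReal ?_
      have ht0 : 0 < t := (h2 n).trans ht.1
      have hht := hpos t ht0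
      have := hmono ht0 (h2 (n + 1)) ht.2
      have ht2 := ht.2
      gcongr
    rw [setLIntegral_const, Real.volume_Ioc, ← ENNReal.ofReal_mul (by positivity)] at h1
    refine le_trans (le_of_eq ?_) (mul_le_mul_right h1 2)
    rw [← ENNReal.ofReal_ofNat 2, ← ENNReal.ofReal_mul (by norm_num)]
    congr 1
    rw [pow_succ]
    field_simp
    ring
  have hdisj : Pairwise (Function.onFun Disjoint fun n : ℕ =>
      Set.Ioc ((2 : ℝ) ^ n) (2 ^ (n + 1))) :=
    (pow_right_mono₀ (one_le_two (α := ℝ))).pairwise_disjoint_on_Ioc_succ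
  have hsum : ∑' n : ℕ, ENNReal.ofReal (1 / h (2 ^ (n + 1)) ^ d) ≤ 2 * testIntegral d h := by
    refine (ENNReal.tsum_le_tsum hn).trans ?_
    rw [ENNReal.tsum_mul_left, ← lintegral_iUnion (fun n => measurableSet_Ioc) hdisj, testIntegral]
    gcongr
    refine Set.iUnion_subset fun n t ht => ?_
    exact (one_le_pow₀ (one_le_two (α := ℝ))).trans_lt ht.1
  rw [tsum_eq_zero_add' ENNReal.summable]
  exact ENNReal.add_ne_top.2 ⟨ENNReal.ofReal_ne_top,
    ne_top_of_le_ne_top (ENNReal.mul_ne_top (by norm_num) hint.ne) hsum⟩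

/-- Convergence forces h to infinity along powers of two. This makes the target time at least
2^(n+1), hence later than every t in the dyadic block. -/
lemma eventually_le_of_testIntegral_lt_top (hpos : ∀ t : ℝ, 0 < t → 0 < h t)
    (hmono : MonotoneOn h (Set.Ioi 0)) (hint : testIntegral d h < ∞) (M : ℝ) :
    ∀ᶠ n : ℕ in atTop, M ≤ h (2 ^ n) := by
  have hlim := ENNReal.tendsto_atTop_zero_of_tsum_ne_top
    (tsum_ne_top_of_testIntegral_lt_top hpos hmono hint)
  set M' := max M 1 with hM'
  have hM0 : 0 < M' := lt_max_of_lt_right one_pos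
  have hc : (0 : ℝ≥0∞) < ENNReal.ofReal (1 / M' ^ d) := ENNReal.ofReal_pos.2 (by positivity)
  filter_upwards [hlim.eventually_lt_const hc] with n hn
  have hh : 0 < h (2 ^ n) := hpos _ (by positivity)
  rw [ENNReal.ofReal_lt_ofReal_iff (by positivity), one_div_lt_one_div (by positivity)
    (by positivity)] at hn
  exact (le_max_left _ _).trans (lt_of_pow_lt_pow_left₀ d hh.le hn).le

/-- Optimality at both ends gives optimality at T, where all values are at most Φ_T(x) ≤ ξ(x).
Positivity of Φ_t(x) confines x to the ball in `earlyPeak`. -/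
lemma mem_earlyPeak_of_eq {Ω : Type*} {ξ : Site d → Ω → ℝ} {ω : Ω} {τ T t s : ℝ}
    (hv : ∀ z, 1 < ξ z ω) {Z : ℝ → Site d} (hZ : IsMaximizerPath (fun z => ξ z ω) Z)
    (ht : 0 < t) (htτ : t ≤ 2 * τ) (htT : t ≤ T) (hTs : T ≤ t + s) (hs : Z t = Z (t + s))
    (hlarge : ∃ z, Real.exp (startHeight d + 1) < Phi (fun z => ξ z ω) t z) :
    ω ∈ earlyPeak ξ τ T := by
  obtain ⟨z₀, hz₀⟩ := hlarge
  have hlarge := hz₀.trans_le (hZ t ht z₀)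
  set x := Z t with hx
  set v : Site d → ℝ := fun z => ξ z ω with hvdef
  have hT : 0 < T := ht.trans_le htT
  have hlev : level d < Phi v t x := by
    refine lt_of_le_of_lt ((level_le_exp le_rfl).trans (Real.exp_le_exp.2 ?_)) hlarge
    linarith
  have hlog := log_of_level_lt_Phi ht (hv x) hlev
  have hv0 : 0 < v x := by linarith [hv x]
  have hmax' : ∀ z, Phi v (t + s) z ≤ Phi v (t + s) x := by
    rw [hs]; exact hZ (t + s) (hT.trans_le hTs)
  have hbet := Phi_le_of_between hv ht htT hTs hlev (hZ t ht) hmax'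
  refine mem_earlyPeak hvdef (x := x) ?_ hv0 ?_ (by linarith) fun z =>
    (hbet z).trans (Phi_le_of_log hT hv0 (by linarith))
  · rw [Real.lt_log_iff_exp_lt hv0]
    exact hlarge.trans_le (Phi_le_of_log ht hv0 (by linarith))
  · have h0 := (level_pos d).trans hlev
    have h1 := Phi_le_sub ht (active_of_Phi_pos h0)
    have h2 : (l1norm x : ℝ) / t * (Real.log (v x) - pathRate d) ≤ v x := by linarith
    rw [div_mul_eq_mul_div, div_le_iff₀ ht] at h2
    nlinarith

variable {Ω : Type*} [MeasurableSpace Ω] {P : Measure Ω} [IsProbabilityMeasure P]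
  {α : ℝ} {ξ : Site d → Ω → ℝ}

theorem IsParetoField.ae_limsup_eq_zero (hd : 1 ≤ d) (hα : (d : ℝ) < α)
    (hξ : IsParetoField P α ξ) (hpos : ∀ t : ℝ, 0 < t → 0 < h t)
    (hmono : MonotoneOn h (Set.Ioi 0)) (hint : testIntegral d h < ∞) :
    ∀ᵐ ω ∂P, ∀ Z : ℝ → Site d, IsMaximizerPath (fun z => ξ z ω) Z →
      limsup (fun t : ℝ => residualLifetime Z t / ENNReal.ofReal (t * h t)) atTop = 0 := by
  have hα0 : 0 < α := (Nat.cast_nonneg d).trans_lt hα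
  obtain ⟨C, hC, hbound⟩ := hξ.exists_measure_earlyPeak_le hd hα
  have hsum := tsum_ne_top_of_testIntegral_lt_top hpos hmono hint
  have hBC : ∀ K : ℕ, ∀ᵐ ω ∂P, ∀ᶠ n : ℕ in atTop,
      ω ∉ earlyPeak ξ (2 ^ n) (2 ^ n * (h (2 ^ n) / (K + 1))) := by
    intro K
    refine ae_eventually_notMem (ne_top_of_le_ne_top (ENNReal.mul_ne_top ENNReal.ofReal_ne_top hsum)
      (b := ENNReal.ofReal (C * (K + 1) ^ d) * _) ?_)
    rw [← ENNReal.tsum_mul_left]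
    refine ENNReal.tsum_le_tsum fun n => ?_
    have hh : 0 < h (2 ^ n) := hpos _ (by positivity)
    refine (hbound (2 ^ n) (h (2 ^ n) / (K + 1)) (one_le_pow₀ one_le_two) (by positivity)).trans
      (le_of_eq ?_)
    rw [← ENNReal.ofReal_mul (by positivity), div_pow]
    congr 1
    field_simp
  filter_upwards [ae_all_iff.2 hBC, hξ.ae_one_lt, hξ.ae_exists_lt hd] with ω hω hv hM Z hZ
  have hK : ∀ K : ℕ, limsup (fun t : ℝ => residualLifetime Z t / ENNReal.ofReal (t * h t)) atTop ≤
      ((K : ℝ≥0∞) + 1)⁻¹ := by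
    intro K
    obtain ⟨N, hN⟩ := eventually_atTop.1 ((hω K).and
      (eventually_le_of_testIntegral_lt_top hpos hmono hint (2 * (K + 1))))
    refine limsup_le_of_le (by isBoundedDefault) ?_
    filter_upwards [eventually_exists_lt_Phi hM (Real.exp (startHeight d + 1)),
      eventually_ge_atTop ((2 : ℝ) ^ (N + 1))] with t hlarge htN
    have ht1 : 1 ≤ t := (one_le_pow₀ one_le_two).trans htN
    have ht0 : 0 < t := by linarith
    obtain ⟨n, hn1, hn2⟩ := exists_nat_pow_near ht1 (one_lt_two (α := ℝ))
    have hnN : N ≤ n := by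
      by_contra hlt
      have : (2 : ℝ) ^ (n + 1) ≤ 2 ^ (N + 1) := pow_le_pow_right₀ one_le_two (by omega)
      linarith
    obtain ⟨hnot, hθ⟩ := hN n hnN
    have h2n : (0 : ℝ) < 2 ^ n := by positivity
    have hK0 : (0 : ℝ) < K + 1 := by positivity
    have hht := hpos t ht0
    by_contra hcon
    rw [not_le] at hcon
    have hlt : ENNReal.ofReal (t * h t / (K + 1)) < residualLifetime Z t := by
      have h0 : ENNReal.ofReal (t * h t) ≠ 0 := (ENNReal.ofReal_pos.2 (by positivity)).ne'
      rw [ENNReal.lt_div_iff_mul_lt (Or.inl h0) (Or.inl ENNReal.ofReal_ne_top)] at hcon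
      rwa [ENNReal.ofReal_div_of_pos hK0, div_eq_mul_inv, mul_comm,
        ENNReal.ofReal_add (by positivity) zero_le_one, ENNReal.ofReal_natCast,
        ENNReal.ofReal_one]
    simp only [residualLifetime, lt_iSup_iff] at hlt
    obtain ⟨s, hs, hlt⟩ := hlt
    have hs' : t * h t / (K + 1) < s := by
      rw [ENNReal.ofReal_lt_iff_lt_toReal (by positivity) ENNReal.coe_ne_top] at hlt
      simpa using hlt
    -- The intermediate time is 2^n h(2^n)/(K+1): after t because this ratio is at least 2, and
    -- before t + s because h is nondecreasing.
    have hθ' : 2 ≤ h (2 ^ n) / (K + 1) := by rwa [le_div_iff₀ hK0]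
    refine hnot (mem_earlyPeak_of_eq hv hZ ht0 (by rw [pow_succ] at hn2; linarith) ?_ ?_ hs hlarge)
    · rw [pow_succ] at hn2
      nlinarith
    · have h1 : h (2 ^ n) ≤ h t := hmono h2n ht0 hn1
      have h3 : 2 ^ n * (h (2 ^ n) / (K + 1)) ≤ t * (h t / (K + 1)) := by gcongr
      rw [mul_div_assoc] at hs'
      linarith
  refine le_antisymm (ge_of_tendsto (x := atTop) ?_ (Eventually.of_forall hK)) zero_le
  have := (ENNReal.tendsto_inv_nat_nhds_zero).comp (tendsto_add_atTop_nat 1)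
  refine this.congr fun K => ?_
  simp

end Convergent

/-! ### Divergent test integrals -/

section Divergent

variable {d : ℕ} {h : ℝ → ℝ}

/-- Condensation along a sequence with bounded growth ratio. No monotonicity of S is needed: the
first index with t ≤ S n places t in one of the covering intervals. -/
lemma tsum_eq_top_of_testIntegral_eq_top (hpos : ∀ t : ℝ, 0 < t → 0 < h t)
    (hmono : MonotoneOn h (Set.Ioi 0)) {S : ℕ → ℝ} {B : ℝ} (hS : ∀ n, 0 < S n)
    (hB : ∀ n, S (n + 1) ≤ B * S n) (hlim : Tendsto S atTop atTop)
    (hint : testIntegral d h = ∞) :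
    ∑' n : ℕ, ENNReal.ofReal (1 / h (S n) ^ d) = ∞ := by
  have hB0 : 0 < B := pos_of_mul_pos_left ((hS 1).trans_le (hB 0)) (hS 0).le
  have hh : ∀ n, 0 < h (S n) := fun n => hpos _ (hS n)
  have hcover : Set.Ioi (1 : ℝ) ⊆ Set.Ioc 1 (S 0) ∪ ⋃ n, Set.Ioc (S n) (S (n + 1)) := by
    intro t ht
    have hex : ∃ n, t ≤ S n := (hlim.eventually_ge_atTop t).exists
    classical
    rcases hn : Nat.find hex with _ | n
    · exact Or.inl ⟨ht, hn ▸ Nat.find_spec hex⟩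
    · refine Or.inr (Set.mem_iUnion.2 ⟨n, ?_, hn ▸ Nat.find_spec hex⟩)
      exact not_le.1 (Nat.find_min hex (by omega))
  have hfirst : ∫⁻ t in Set.Ioc (1 : ℝ) (S 0), ENNReal.ofReal (1 / (t * h t ^ d)) < ∞ := by
    have h1 := hpos 1 one_pos
    refine lt_of_le_of_lt (setLIntegral_mono' (g := fun _ => ENNReal.ofReal (1 / (1 * h 1 ^ d)))
      measurableSet_Ioc fun t ht => ENNReal.ofReal_le_ofReal ?_) ?_
    · have ht1 := ht.1
      have ht0 : (0 : ℝ) < t := by linarith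
      have := hmono (Set.mem_Ioi.2 one_pos) ht0 ht1.le
      gcongr
    · rw [setLIntegral_const, Real.volume_Ioc]
      exact ENNReal.mul_lt_top ENNReal.ofReal_lt_top ENNReal.ofReal_lt_top
  have hstep : ∀ n, ∫⁻ t in Set.Ioc (S n) (S (n + 1)), ENNReal.ofReal (1 / (t * h t ^ d)) ≤
      ENNReal.ofReal B * ENNReal.ofReal (1 / h (S n) ^ d) := by
    intro n
    have hSn := hS n
    have hhn := hh n
    refine (setLIntegral_mono' (g := fun _ => ENNReal.ofReal (1 / (S n * h (S n) ^ d)))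
      measurableSet_Ioc fun t ht => ENNReal.ofReal_le_ofReal ?_).trans ?_
    · have ht1 := ht.1
      have ht0 : (0 : ℝ) < t := by linarith
      have := hmono hSn ht0 ht1.le
      gcongr
    · rw [setLIntegral_const, Real.volume_Ioc, ← ENNReal.ofReal_mul (by positivity),
        ← ENNReal.ofReal_mul hB0.le]
      refine ENNReal.ofReal_le_ofReal ?_
      calc 1 / (S n * h (S n) ^ d) * (S (n + 1) - S n)
          ≤ 1 / (S n * h (S n) ^ d) * (B * S n) := by
            gcongr; linarith [hB n]
        _ = B * (1 / h (S n) ^ d) := by field_simp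
  by_contra hne
  refine (lt_irrefl (∞ : ℝ≥0∞)) ?_
  calc ∞ = testIntegral d h := hint.symm
    _ ≤ ∫⁻ t in Set.Ioc 1 (S 0) ∪ ⋃ n, Set.Ioc (S n) (S (n + 1)),
          ENNReal.ofReal (1 / (t * h t ^ d)) := lintegral_mono_set hcover
    _ ≤ (∫⁻ t in Set.Ioc (1 : ℝ) (S 0), ENNReal.ofReal (1 / (t * h t ^ d))) +
          ∑' n, ∫⁻ t in Set.Ioc (S n) (S (n + 1)), ENNReal.ofReal (1 / (t * h t ^ d)) :=
        (lintegral_union_le _ _ _).trans (by gcongr; exact lintegral_iUnion_le _ _)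
    _ ≤ (∫⁻ t in Set.Ioc (1 : ℝ) (S 0), ENNReal.ofReal (1 / (t * h t ^ d))) +
          ENNReal.ofReal B * ∑' n : ℕ, ENNReal.ofReal (1 / h (S n) ^ d) := by
        gcongr
        rw [← ENNReal.tsum_mul_left]
        exact ENNReal.tsum_le_tsum hstep
    _ < ∞ := ENNReal.add_lt_top.2 ⟨hfirst, ENNReal.mul_lt_top ENNReal.ofReal_lt_top
        (lt_top_iff_ne_top.2 hne)⟩

/-- The time at which a peak of height `eⁿ` is optimal with probability close to one. -/
noncomputable def peakTime (d : ℕ) (α c : ℝ) (n : ℕ) : ℝ := c * n * Real.exp (n * (α / d - 1))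

/-- A site that is a peak in the ball of radius `ρ` and dominates all others. -/
def peakIn {Ω : Type*} (ξ : Site d → Ω → ℝ) (T ρ : ℝ) (n : ℕ) : Set Ω :=
  ⋃ x ∈ latticeBall d ρ, isolatedPeak ξ T (Real.exp (n - 1)) n x

/-- The radius is computed from the earlier time t, so the peak exceeds e^(n-1) from t on.
Domination at T passes to earlier times because Φ increases above the level. -/
lemma le_residualLifetime_of_mem_peakIn {Ω : Type*} {ξ : Site d → Ω → ℝ} {ω : Ω} {t T : ℝ} {n : ℕ}
    (hv : ∀ z, 1 < ξ z ω) {Z : ℝ → Site d} (hZ : IsMaximizerPath (fun z => ξ z ω) Z)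
    (ht : 0 < t) (htT : t ≤ T) (hn : level d ≤ Real.exp (n - 1))
    (hω : ω ∈ peakIn ξ T (t * Real.exp (n - 1) / (n + 1)) n) :
    ENNReal.ofReal (T - t) ≤ residualLifetime Z t ∧ Real.exp n < ξ (Z t) ω := by
  simp only [peakIn, Set.mem_iUnion] at hω
  obtain ⟨x, hx, hpeak, hdom⟩ := hω
  rw [mem_latticeBall] at hx
  have hZx : ∀ s, t ≤ s → s ≤ T → Z s = x := by
    intro s hts hsT
    have hs : 0 < s := ht.trans_le hts
    by_contra hne
    have h1 := lt_Phi_of_mem_Ioc (v := fun z => ξ z ω) hs hpeak (hx.trans (by gcongr))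
    have h2 := Phi_le_of_Phi_le (v := fun z => ξ z ω) hs hsT (hv _) hn (hdom _ hne)
    have h3 := hZ s hs x
    linarith
  refine ⟨?_, by rw [hZx t le_rfl htT]; exact hpeak.1⟩
  refine le_iSup₂_of_le (Real.toNNReal (T - t)) ?_ le_rfl
  rw [Real.coe_toNNReal _ (sub_nonneg.2 htT), add_sub_cancel, hZx t le_rfl htT,
    hZx T htT le_rfl]

variable {Ω : Type*} [MeasurableSpace Ω] {P : Measure Ω} [IsProbabilityMeasure P]
  {α : ℝ} {ξ : Site d → Ω → ℝ} {T ρ δ : ℝ} {n : ℕ}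

lemma IsParetoField.measurableSet_peakIn (hξ : IsParetoField P α ξ) (T ρ : ℝ) (n : ℕ) :
    MeasurableSet (peakIn ξ T ρ n) :=
  Finset.measurableSet_biUnion _ fun _ _ => hξ.measurableSet_isolatedPeak _ _ _ _

/-- The expected number of sites in the ball of radius `ρ` with potential in `(eⁿ, eⁿ⁺¹]`. -/
noncomputable def expectedPeaks (d : ℕ) (α ρ : ℝ) (n : ℕ) : ℝ :=
  (latticeBall d ρ).card * (paretoUnit α * Real.exp (-α * n))

lemma IsParetoField.measureReal_peakIn (hξ : IsParetoField P α ξ) (hα : 0 < α) (hT : 0 < T)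
    (hρ : ρ ≤ T * Real.exp (n - 1) / (n + 1)) :
    P.real (peakIn ξ T ρ n) = ∑ x ∈ latticeBall d ρ,
      paretoUnit α * Real.exp (-α * n) * P.real (dominated ξ T (Real.exp (n - 1)) x) := by
  have := paretoUnit_pos hα
  rw [peakIn, measureReal_biUnion_finset]
  · refine Finset.sum_congr rfl fun x _ => ?_
    rw [Measure.real, hξ.measure_isolatedPeak hα, ENNReal.toReal_mul,
      ENNReal.toReal_ofReal (by positivity), Measure.real]
  · intro x hx y hy hxy
    refine Set.disjoint_left.2 fun ω h h' => hxy ?_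
    exact (isolatedPeak_unique (b := fun n => Real.exp (n - 1)) hT le_rfl le_rfl
      ((mem_latticeBall.1 hx).trans hρ) ((mem_latticeBall.1 hy).trans hρ) h h').2
  · exact fun x _ => hξ.measurableSet_isolatedPeak _ _ _ _

lemma IsParetoField.measureReal_peakIn_le (hξ : IsParetoField P α ξ) (hα : 0 < α) (hT : 0 < T)
    (hρ : ρ ≤ T * Real.exp (n - 1) / (n + 1)) :
    P.real (peakIn ξ T ρ n) ≤ expectedPeaks d α ρ n := by
  have := paretoUnit_pos hα
  rw [hξ.measureReal_peakIn hα hT hρ, expectedPeaks, ← nsmul_eq_mul]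
  exact Finset.sum_le_card_nsmul _ _ _ fun x _ =>
    mul_le_of_le_one_right (by positivity) measureReal_le_one

lemma IsParetoField.le_measureReal_peakIn (hξ : IsParetoField P α ξ) (hα : 0 < α) (hT : 0 < T)
    (hρ : ρ ≤ T * Real.exp (n - 1) / (n + 1)) (hδ : 0 ≤ δ)
    (hdom : ∀ x, P (dominated ξ T (Real.exp (n - 1)) x)ᶜ ≤ ENNReal.ofReal δ) :
    (1 - δ) * expectedPeaks d α ρ n ≤ P.real (peakIn ξ T ρ n) := by
  have := paretoUnit_pos hα
  rw [hξ.measureReal_peakIn hα hT hρ]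
  have h1 : (1 - δ) * expectedPeaks d α ρ n = (latticeBall d ρ).card •
      (paretoUnit α * Real.exp (-α * n) * (1 - δ)) := by
    rw [expectedPeaks, nsmul_eq_mul]; ring
  rw [h1]
  refine Finset.card_nsmul_le_sum _ _ _ fun x _ => ?_
  refine mul_le_mul_of_nonneg_left ?_ (by positivity)
  have h2 : P.real (dominated ξ T (Real.exp (n - 1)) x)ᶜ ≤ δ :=
    ENNReal.toReal_le_of_le_ofReal hδ (hdom x)
  rw [probReal_compl_eq_one_sub (hξ.measurableSet_dominated _ _ _)] at h2
  linarith

/-- Domination is dropped and only the heights are kept. Distinct sites are independent, and one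
site cannot lie in two disjoint height classes. -/
lemma IsParetoField.measureReal_peakIn_inter_le (hξ : IsParetoField P α ξ) (hα : 0 < α)
    {T' ρ' : ℝ} {m : ℕ} (hnm : n ≠ m) :
    P.real (peakIn ξ T ρ n ∩ peakIn ξ T' ρ' m) ≤
      expectedPeaks d α ρ n * expectedPeaks d α ρ' m := by
  have hs := paretoUnit_pos hα
  set I : ℕ → Set ℝ := fun n => Set.Ioc (Real.exp n) (Real.exp (n + 1)) with hI
  have hIm : ∀ k z, P.real (ξ z ⁻¹' I k) = paretoUnit α * Real.exp (-α * k) := fun k z => by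
    rw [Measure.real, hξ.measure_Ioc_exp hα, ENNReal.toReal_ofReal (by positivity)]
  have hdisj : Disjoint (I n) (I m) := by
    refine Set.disjoint_left.2 fun y h1 h2 => hnm ?_
    have h3 : Real.exp n < Real.exp (m + 1) := h1.1.trans_le h2.2
    have h4 : Real.exp m < Real.exp (n + 1) := h2.1.trans_le h1.2
    rw [Real.exp_lt_exp] at h3 h4
    norm_cast at h3 h4
    omega
  have hpair : ∀ x y, P.real (ξ x ⁻¹' I n ∩ ξ y ⁻¹' I m) ≤
      (paretoUnit α * Real.exp (-α * n)) * (paretoUnit α * Real.exp (-α * m)) := by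
    intro x y
    rcases eq_or_ne x y with rfl | hxy
    · rw [← Set.preimage_inter, hdisj.inter_eq, Set.preimage_empty, measureReal_empty]
      positivity
    · rw [← hIm n x, ← hIm m y, Measure.real, Measure.real, Measure.real,
        hξ.measure_inter_preimage hxy measurableSet_Ioc measurableSet_Ioc, ENNReal.toReal_mul]
  have hsub : peakIn ξ T ρ n ∩ peakIn ξ T' ρ' m ⊆
      ⋃ x ∈ latticeBall d ρ, ⋃ y ∈ latticeBall d ρ', (ξ x ⁻¹' I n ∩ ξ y ⁻¹' I m) := by
    rintro ω ⟨h1, h2⟩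
    simp only [peakIn, Set.mem_iUnion] at h1 h2
    obtain ⟨x, hx, hωx⟩ := h1
    obtain ⟨y, hy, hωy⟩ := h2
    exact Set.mem_biUnion hx (Set.mem_biUnion hy ⟨hωx.1, hωy.1⟩)
  calc P.real (peakIn ξ T ρ n ∩ peakIn ξ T' ρ' m)
      ≤ P.real (⋃ x ∈ latticeBall d ρ, ⋃ y ∈ latticeBall d ρ', (ξ x ⁻¹' I n ∩ ξ y ⁻¹' I m)) :=
        measureReal_mono hsub (measure_ne_top _ _)
    _ ≤ ∑ x ∈ latticeBall d ρ, ∑ y ∈ latticeBall d ρ', P.real (ξ x ⁻¹' I n ∩ ξ y ⁻¹' I m) :=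
        (measureReal_biUnion_finset_le _ _).trans
          (Finset.sum_le_sum fun x _ => measureReal_biUnion_finset_le _ _)
    _ ≤ ∑ x ∈ latticeBall d ρ, ∑ y ∈ latticeBall d ρ',
          (paretoUnit α * Real.exp (-α * n)) * (paretoUnit α * Real.exp (-α * m)) :=
        Finset.sum_le_sum fun x _ => Finset.sum_le_sum fun y _ => hpair x y
    _ = _ := by
        simp only [Finset.sum_const, nsmul_eq_mul, expectedPeaks]; ring

lemma IsParetoField.exists_measure_compl_dominated_le (hd : 1 ≤ d) (hα : (d : ℝ) < α)
    (hξ : IsParetoField P α ξ) (hδ : 0 < δ) : ∃ c : ℝ, 0 < c ∧ ∀ᶠ n : ℕ in atTop, ∀ x,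
      P (dominated ξ (peakTime d α c n) (Real.exp (n - 1)) x)ᶜ ≤ ENNReal.ofReal δ := by
  have hα0 : 0 < α := (Nat.cast_nonneg d).trans_lt hα
  have hd0 : (0 : ℝ) < d := by exact_mod_cast hd
  obtain ⟨C, hC, hsum⟩ := exists_tsum_site_rpow_le hd hα
  set γ := α / d with hγ
  have hγ0 : 0 < γ := by positivity
  have hδ' : 0 < min δ 1 := lt_min hδ one_pos
  -- The lattice sum is at most (C e^γ (e^(-nγ) + 2c))^d. For large n the bracket is at most 3c, so
  -- this c gives (min δ 1)^d; the minimum with 1 lets the d-th power be dropped.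
  refine ⟨min δ 1 / (3 * C * Real.exp γ), by positivity, ?_⟩
  set c := min δ 1 / (3 * C * Real.exp γ) with hc
  have hc0 : 0 < c := by positivity
  have hcast : Tendsto (fun n : ℕ => (n : ℝ)) atTop atTop := tendsto_natCast_atTop_atTop
  have hexp : ∀ᶠ n : ℕ in atTop, Real.exp (-(n * γ)) ≤ c := by
    have : Tendsto (fun n : ℕ => Real.exp (-(n * γ))) atTop (𝓝 0) :=
      Real.tendsto_exp_neg_atTop_nhds_zero.comp (hcast.atTop_mul_const hγ0)
    exact (this.eventually_lt_const hc0).mono fun _ => le_of_lt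
  filter_upwards [hexp, hcast.eventually_ge_atTop (2 * (1 + pathRate d)),
    hcast.eventually_ge_atTop (startHeight d + 1)] with n hn1 hn2 hn3 x
  have hκ := pathRate_nonneg d
  have hn0 : (0 : ℝ) < n := by linarith
  have hT : 0 < peakTime d α c n := by unfold peakTime; positivity
  have hlev : level d ≤ Real.exp (n - 1) :=
    (level_le_exp le_rfl).trans (Real.exp_le_exp.2 (by linarith))
  refine (hξ.measure_compl_dominated_le hα0 hT hlev x).trans ?_
  rw [Real.log_exp]
  have hu0 : 0 < ((n : ℝ) - 1 - pathRate d) / peakTime d α c n := div_pos (by linarith) hT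
  refine (hsum _ _ (Real.exp_pos _) hu0).trans (ENNReal.ofReal_le_ofReal ?_)
  have hb : Real.exp ((n : ℝ) - 1) ^ (-γ) = Real.exp γ * Real.exp (-(n * γ)) := by
    rw [← Real.exp_mul, ← Real.exp_add]; congr 1; ring
  have hbu : Real.exp ((n : ℝ) - 1) / (((n : ℝ) - 1 - pathRate d) / peakTime d α c n) ≤
      2 * c * Real.exp (n * γ) := by
    rw [div_div_eq_mul_div, div_le_iff₀ (by linarith), peakTime, ← hγ]
    have e1 : Real.exp ((n : ℝ) - 1) * (c * n * Real.exp (n * (γ - 1))) =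
        c * n * Real.exp (n * γ - 1) := by
      rw [mul_comm, mul_assoc, ← Real.exp_add]; congr 2; ring
    rw [e1]
    have e2 : Real.exp (n * γ - 1) ≤ Real.exp (n * γ) := Real.exp_le_exp.2 (by linarith)
    calc c * n * Real.exp (n * γ - 1) ≤ c * (2 * (n - 1 - pathRate d)) * Real.exp (n * γ) := by
          have e3 : (n : ℝ) ≤ 2 * (n - 1 - pathRate d) := by linarith
          exact mul_le_mul (mul_le_mul_of_nonneg_left e3 hc0.le) e2 (Real.exp_pos _).le
            (mul_nonneg hc0.le (by linarith))
      _ = _ := by ring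
  have hmain : C * (Real.exp ((n : ℝ) - 1) ^ (-γ) *
      (1 + Real.exp ((n : ℝ) - 1) / (((n : ℝ) - 1 - pathRate d) / peakTime d α c n))) ≤
      min δ 1 := by
    rw [hb]
    calc C * (Real.exp γ * Real.exp (-(n * γ)) *
          (1 + Real.exp ((n : ℝ) - 1) / (((n : ℝ) - 1 - pathRate d) / peakTime d α c n)))
        ≤ C * (Real.exp γ * Real.exp (-(n * γ)) * (1 + 2 * c * Real.exp (n * γ))) := by gcongr
      _ = C * Real.exp γ * (Real.exp (-(n * γ)) +
          2 * c * (Real.exp (-(n * γ)) * Real.exp (n * γ))) := by ring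
      _ = C * Real.exp γ * (Real.exp (-(n * γ)) + 2 * c) := by
          rw [← Real.exp_add, neg_add_cancel, Real.exp_zero, mul_one]
      _ ≤ C * Real.exp γ * (c + 2 * c) := by gcongr
      _ = min δ 1 := by rw [hc]; field_simp; ring
  calc _ ≤ (min δ 1) ^ d := pow_le_pow_left₀ (by positivity) hmain d
    _ ≤ min δ 1 := pow_le_of_le_one hδ'.le (min_le_right _ _) (by omega)
    _ ≤ δ := min_le_left _ _

/-- The time scale is tuned so that the ball has volume of order e^(nα)/θ^d, which cancels the
Pareto weight e^(-αn) and leaves only θ. -/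
lemma le_expectedPeaks (hd : 1 ≤ d) (hα : 0 < α) {c θ : ℝ} (hc : 0 < c) (hθ : 0 < θ)
    (hn : 1 ≤ n) :
    (c * Real.exp (-1) / (2 * d)) ^ d * paretoUnit α / θ ^ d ≤
      expectedPeaks d α (peakTime d α c n / θ * Real.exp (n - 1) / (n + 1)) n := by
  have hd0 : (0 : ℝ) < d := by exact_mod_cast hd
  have hn1 : (1 : ℝ) ≤ n := by exact_mod_cast hn
  have hs := paretoUnit_pos hα
  have hT : 0 < peakTime d α c n := by unfold peakTime; positivity
  have hcard := le_card_latticeBall hd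
    (r := peakTime d α c n / θ * Real.exp (n - 1) / (n + 1)) (by positivity)
  have hρ : c * Real.exp (-1) / (2 * d) / θ * Real.exp (n * (α / d)) ≤
      peakTime d α c n / θ * Real.exp (n - 1) / (n + 1) / d := by
    have e1 : peakTime d α c n / θ * Real.exp (n - 1) / (n + 1) / d =
        c * Real.exp (-1) / d / θ * Real.exp (n * (α / d)) * (n / (n + 1)) := by
      have : Real.exp (n * (α / d - 1)) * Real.exp (n - 1) =
          Real.exp (-1) * Real.exp (n * (α / d)) := by
        rw [← Real.exp_add, ← Real.exp_add]; congr 1; ring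
      rw [peakTime]
      calc c * n * Real.exp (n * (α / d - 1)) / θ * Real.exp (n - 1) / (n + 1) / d
          = c * n / θ * (Real.exp (n * (α / d - 1)) * Real.exp (n - 1)) / (n + 1) / d := by ring
        _ = _ := by rw [this]; ring
    have e2 : (1 / 2 : ℝ) ≤ n / (n + 1) := by
      rw [div_le_div_iff₀ two_pos (by positivity)]; linarith
    rw [e1]
    calc c * Real.exp (-1) / (2 * d) / θ * Real.exp (n * (α / d))
        = c * Real.exp (-1) / d / θ * Real.exp (n * (α / d)) * (1 / 2) := by
          field_simp
      _ ≤ _ := by gcongr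
  have hpow := pow_le_pow_left₀ (by positivity) hρ d
  have e3 : Real.exp (n * (α / d)) ^ d = Real.exp (n * α) := by
    rw [← Real.exp_nat_mul]; congr 1; field_simp
  rw [mul_pow, e3, div_pow _ θ] at hpow
  calc (c * Real.exp (-1) / (2 * d)) ^ d * paretoUnit α / θ ^ d
      = ((c * Real.exp (-1) / (2 * d)) ^ d / θ ^ d * Real.exp (n * α)) *
        (paretoUnit α * Real.exp (-α * n)) := by
        have : Real.exp (n * α) * Real.exp (-α * n) = 1 := by
          rw [← Real.exp_add, show n * α + -α * n = 0 by ring, Real.exp_zero]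
        linear_combination (-((c * Real.exp (-1) / (2 * d)) ^ d / θ ^ d) * paretoUnit α) * this
    _ ≤ _ := mul_le_mul_of_nonneg_right (hpow.trans hcard) (by positivity)

lemma peakTime_succ_le {c : ℝ} (hc : 0 < c) (hn : 1 ≤ n) :
    peakTime d α c (n + 1) ≤ 2 * Real.exp (α / d - 1) * peakTime d α c n := by
  have hn1 : (1 : ℝ) ≤ n := by exact_mod_cast hn
  have e : Real.exp (((n + 1 : ℕ) : ℝ) * (α / d - 1)) =
      Real.exp (α / d - 1) * Real.exp (n * (α / d - 1)) := by
    rw [← Real.exp_add]; congr 1; push_cast; ring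
  rw [peakTime, peakTime, e]
  have h2 : ((n + 1 : ℕ) : ℝ) ≤ 2 * n := by push_cast; linarith
  calc c * ((n + 1 : ℕ) : ℝ) * (Real.exp (α / d - 1) * Real.exp (n * (α / d - 1)))
      ≤ c * (2 * n) * (Real.exp (α / d - 1) * Real.exp (n * (α / d - 1))) := by gcongr
    _ = _ := by ring

lemma mul_le_peakTime (hd : 1 ≤ d) (hα : (d : ℝ) < α) {c : ℝ} (hc : 0 < c) :
    c * n ≤ peakTime d α c n := by
  have hd0 : (0 : ℝ) < d := by exact_mod_cast hd
  have hγ : 0 ≤ α / d - 1 := by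
    have := (one_lt_div hd0).2 hα
    linarith
  exact le_mul_of_one_le_right (by positivity) (Real.one_le_exp (by positivity))

lemma not_summable_expectedPeaks (hd : 1 ≤ d) (hα : (d : ℝ) < α)
    (hpos : ∀ t : ℝ, 0 < t → 0 < h t) (hmono : MonotoneOn h (Set.Ioi 0))
    (hint : testIntegral d h = ∞) {c K : ℝ} (hc : 0 < c) (hK : 0 ≤ K) {N : ℕ} (hN : 1 ≤ N) :
    ¬ Summable fun n => expectedPeaks d α (peakTime d α c (n + N) /
      (K * h (peakTime d α c (n + N)) + 1) * Real.exp ((n + N : ℕ) - 1) / ((n + N : ℕ) + 1))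
      (n + N) := by
  intro hsum
  have hα0 : 0 < α := (Nat.cast_nonneg d).trans_lt hα
  have hd0 : (0 : ℝ) < d := by exact_mod_cast hd
  have hs := paretoUnit_pos hα0
  have hhc := hpos c hc
  have hTc : ∀ n, c ≤ peakTime d α c (n + N) := fun n => by
    refine le_trans ?_ (mul_le_peakTime hd hα hc)
    have : (1 : ℝ) ≤ (n + N : ℕ) := by exact_mod_cast (by omega : 1 ≤ n + N)
    nlinarith
  have hT0 : ∀ n, 0 < peakTime d α c (n + N) := fun n => hc.trans_le (hTc n)
  have hlim : Tendsto (fun n => peakTime d α c (n + N)) atTop atTop := by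
    refine tendsto_atTop_mono (fun n => mul_le_peakTime hd hα hc) ?_
    exact (tendsto_natCast_atTop_atTop.comp (tendsto_add_atTop_nat N)).const_mul_atTop hc
  have htop := tsum_eq_top_of_testIntegral_eq_top (S := fun n => peakTime d α c (n + N)) hpos hmono
    hT0 (B := 2 * Real.exp (α / d - 1))
    (fun n => by
      have := peakTime_succ_le (d := d) (α := α) hc (n := n + N) (by omega)
      rwa [add_right_comm] at this) hlim hint
  refine Summable.tsum_ofReal_ne_top (f := fun n => 1 / h (peakTime d α c (n + N)) ^ d) ?_ htop
  set A := (c * Real.exp (-1) / (2 * d)) ^ d * paretoUnit α with hA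
  have hA0 : 0 < A := by positivity
  -- Since all the times are at least c, h is at least h(c) there, so the summand 1 in Kh + 1 is
  -- absorbed into a multiple of h.
  set L := K + 1 / h c with hL
  have hL0 : 0 < L := by positivity
  refine Summable.of_nonneg_of_le (fun n => ?_) (fun n => ?_) (hsum.mul_left (L ^ d / A))
  · have := hpos _ (hT0 n); positivity
  · have hh := hpos _ (hT0 n)
    have hcT : h c ≤ h (peakTime d α c (n + N)) := hmono hc (hT0 n) (hTc n)
    have hθ : K * h (peakTime d α c (n + N)) + 1 ≤ L * h (peakTime d α c (n + N)) := by
      have : 1 ≤ 1 / h c * h (peakTime d α c (n + N)) := by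
        rw [div_mul_eq_mul_div, one_mul, one_le_div hhc]; exact hcT
      rw [hL]; linarith
    have hlow := le_expectedPeaks (d := d) (α := α) hd hα0 hc
      (θ := K * h (peakTime d α c (n + N)) + 1) (by positivity) (n := n + N) (by omega)
    have h1 : A / (L * h (peakTime d α c (n + N))) ^ d ≤
        A / (K * h (peakTime d α c (n + N)) + 1) ^ d := by gcongr
    calc 1 / h (peakTime d α c (n + N)) ^ d
        = L ^ d / A * (A / (L * h (peakTime d α c (n + N))) ^ d) := by
          rw [mul_pow]; field_simp
      _ ≤ _ := mul_le_mul_of_nonneg_left (h1.trans hlow) (by positivity)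

lemma frequently_of_frequently_mem_peakIn {ω : Ω} (hv : ∀ z, 1 < ξ z ω)
    (hfin : ∀ t : ℝ, {z : Site d | (l1norm z : ℝ) ≤ t * ξ z ω}.Finite)
    (hpos : ∀ t : ℝ, 0 < t → 0 < h t) (hmono : MonotoneOn h (Set.Ioi 0)) (K : ℕ) {S : ℕ → ℝ}
    (hS : ∀ n : ℕ, 1 ≤ n → 0 < S n)
    (hfreq : ∃ᶠ n : ℕ in atTop, ω ∈ peakIn ξ (S n)
      (S n / (K * h (S n) + 1) * Real.exp (n - 1) / (n + 1)) n)
    {Z : ℝ → Site d} (hZ : IsMaximizerPath (fun z => ξ z ω) Z) :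
    ∃ᶠ t : ℝ in atTop, (K : ℝ≥0∞) ≤ residualLifetime Z t / ENNReal.ofReal (t * h t) := by
  rw [frequently_atTop]
  intro A
  obtain ⟨M, hM⟩ := ((hfin A).image fun z => ξ z ω).bddAbove
  have hcast : Tendsto (fun n : ℕ => (n : ℝ)) atTop atTop := tendsto_natCast_atTop_atTop
  obtain ⟨n, hω, hn1, hn2, hn3⟩ := (hfreq.and_eventually ((eventually_ge_atTop 1).and
    ((hcast.eventually_ge_atTop M).and (hcast.eventually_ge_atTop (startHeight d + 1))))).exists
  have hlev : level d ≤ Real.exp (n - 1) :=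
    (level_le_exp le_rfl).trans (Real.exp_le_exp.2 (by linarith))
  set T := S n with hT
  have hT0 : 0 < T := hS n hn1
  have hhT := hpos T hT0
  set θ := K * h T + 1 with hθ
  have hθ1 : 1 ≤ θ := by
    have : 0 ≤ K * h T := by positivity
    linarith
  have hθ0 : 0 < θ := by linarith
  have ht0 : 0 < T / θ := by positivity
  have htT : T / θ ≤ T := div_le_self hT0.le hθ1
  obtain ⟨hR, hpeak⟩ := le_residualLifetime_of_mem_peakIn hv hZ ht0 htT hlev hω
  refine ⟨T / θ, ?_, ?_⟩
  -- h may grow so fast that T/θ is not obviously unbounded. If T/θ < A, the maximizer would be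
  -- among the finitely many sites active at time A, whose potentials are at most M, whereas the
  -- peak exceeds e^n > M.
  · by_contra hlt
    have hact := active_of_isMax hv ht0 (hZ _ ht0)
    have hmem : Z (T / θ) ∈ {z : Site d | (l1norm z : ℝ) ≤ A * ξ z ω} :=
      hact.trans (mul_le_mul_of_nonneg_right (not_le.1 hlt).le (by linarith [hv (Z (T / θ))]))
    have h1 := hM (Set.mem_image_of_mem _ hmem)
    have h2 := Real.add_one_le_exp (n : ℝ)
    linarith
  · have hht := hpos _ ht0
    have h0 : ENNReal.ofReal (T / θ * h (T / θ)) ≠ 0 := (ENNReal.ofReal_pos.2 (by positivity)).ne'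
    rw [ENNReal.le_div_iff_mul_le (Or.inl h0) (Or.inl ENNReal.ofReal_ne_top)]
    refine le_trans ?_ hR
    rw [← ENNReal.ofReal_natCast, ← ENNReal.ofReal_mul (by positivity)]
    refine ENNReal.ofReal_le_ofReal ?_
    have hhle : h (T / θ) ≤ h T := hmono ht0 hT0 htT
    calc (K : ℝ) * (T / θ * h (T / θ)) ≤ K * (T / θ * h T) := by gcongr
      -- The summand 1 in θ makes this an identity: T - T/θ = (θ - 1)T/θ.
      _ = T - T / θ := by rw [hθ]; field_simp; ring

theorem IsParetoField.ae_limsup_eq_top (hd : 1 ≤ d) (hα : (d : ℝ) < α)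
    (hξ : IsParetoField P α ξ) (hpos : ∀ t : ℝ, 0 < t → 0 < h t)
    (hmono : MonotoneOn h (Set.Ioi 0)) (hint : testIntegral d h = ∞) :
    ∀ᵐ ω ∂P, ∀ Z : ℝ → Site d, IsMaximizerPath (fun z => ξ z ω) Z →
      limsup (fun t : ℝ => residualLifetime Z t / ENNReal.ofReal (t * h t)) atTop = ∞ := by
  have hα0 : 0 < α := (Nat.cast_nonneg d).trans_lt hα
  have hgood : ∀ᵐ ω ∂P, (∀ z, 1 < ξ z ω) ∧
      ∀ t : ℝ, {z : Site d | (l1norm z : ℝ) ≤ t * ξ z ω}.Finite :=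
    hξ.ae_one_lt.and (hξ.ae_finite_active hd hα)
  have hK : ∀ K : ℕ, ∀ᵐ ω ∂P, ∀ Z : ℝ → Site d, IsMaximizerPath (fun z => ξ z ω) Z →
      ∃ᶠ t : ℝ in atTop, (K : ℝ≥0∞) ≤ residualLifetime Z t / ENNReal.ofReal (t * h t) := by
    intro K
    rw [ae_iff]
    refine le_antisymm (ENNReal.le_of_forall_pos_le_add fun ε hε _ => ?_) zero_le
    -- The constant c, and with it the peak events, depend on ε. The exceptional set does not, so
    -- bounding its outer measure by every ε makes it null.
    have hε' : (0 : ℝ) < ε / 2 := by positivity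
    obtain ⟨c, hc, hev⟩ := hξ.exists_measure_compl_dominated_le hd hα hε'
    obtain ⟨N, hN⟩ := eventually_atTop.1 (hev.and (eventually_ge_atTop 1))
    have hN1 : 1 ≤ N := (hN N le_rfl).2
    set S : ℕ → ℝ := peakTime d α c with hS
    have hS0 : ∀ n : ℕ, 1 ≤ n → 0 < S n := fun n hn => by
      have : (0 : ℝ) < n := by exact_mod_cast hn
      rw [hS]; unfold peakTime; positivity
    set ρ : ℕ → ℝ := fun n => S n / (K * h (S n) + 1) * Real.exp (n - 1) / (n + 1) with hρ
    have hρle : ∀ n : ℕ, 1 ≤ n → ρ n ≤ S n * Real.exp (n - 1) / (n + 1) := fun n hn => by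
      have h1 := hpos _ (hS0 n hn)
      have h2 : 0 ≤ K * h (S n) := by positivity
      have h3 : S n / (K * h (S n) + 1) ≤ S n := div_le_self (hS0 n hn).le (by linarith)
      rw [hρ]
      dsimp only
      gcongr
    have hlim := sub_le_measureReal_limsup (P := P)
      (E := fun n => peakIn ξ (S (n + N)) (ρ (n + N)) (n + N))
      (p := fun n => expectedPeaks d α (ρ (n + N)) (n + N)) (δ := ε / 2)
      (fun n => hξ.measurableSet_peakIn _ _ _)
      (fun n => hξ.le_measureReal_peakIn hα0 (hS0 _ (by omega)) (hρle _ (by omega)) hε'.le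
        (hN (n + N) (by omega)).1)
      (fun n => hξ.measureReal_peakIn_le hα0 (hS0 _ (by omega)) (hρle _ (by omega)))
      (fun n m hnm => hξ.measureReal_peakIn_inter_le hα0 (by omega))
      (not_summable_expectedPeaks hd hα hpos hmono hint hc (Nat.cast_nonneg K) hN1)
    set F := limsup (fun n => peakIn ξ (S (n + N)) (ρ (n + N)) (n + N)) atTop with hF
    have hFm : MeasurableSet F := MeasurableSet.measurableSet_limsup fun n =>
      hξ.measurableSet_peakIn _ _ _
    have hFc : P Fᶜ ≤ ε := by
      have h1 : P.real Fᶜ ≤ ε := by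
        rw [probReal_compl_eq_one_sub hFm]; linarith
      rw [← ENNReal.ofReal_coe_nnreal]
      exact (ENNReal.le_ofReal_iff_toReal_le (measure_ne_top _ _) ε.2).2 h1
    rw [zero_add]
    refine le_trans (measure_mono_ae ?_) hFc
    filter_upwards [hgood] with ω hω hnot hωF
    refine hnot fun Z hZ => ?_
    refine frequently_of_frequently_mem_peakIn hω.1 hω.2 hpos hmono K hS0 ?_ hZ
    have h1 : ∃ᶠ n : ℕ in atTop, ω ∈ peakIn ξ (S (n + N)) (ρ (n + N)) (n + N) :=
      mem_limsup_iff_frequently_mem.1 hωF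
    exact (tendsto_add_atTop_nat N).frequently h1
  filter_upwards [ae_all_iff.2 hK] with ω hω Z hZ
  refine top_le_iff.1 (le_of_tendsto ENNReal.tendsto_nat_nhds_top (Eventually.of_forall fun K => ?_))
  exact le_limsup_of_frequently_le (hω K Z hZ) (by isBoundedDefault)

end Divergent

end PAM

theorem mainTheorem9 {Ω : Type*} [MeasurableSpace Ω] (P : Measure Ω) [IsProbabilityMeasure P]
    (d : ℕ) (hd : 1 ≤ d) (α : ℝ) (hα : (d : ℝ) < α)
    (ξ : PAM.Site d → Ω → ℝ) (hξ : PAM.IsParetoField P α ξ)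
    (h : ℝ → ℝ) (hpos : ∀ t : ℝ, 0 < t → 0 < h t) (hmono : MonotoneOn h (Set.Ioi 0)) :
    ∀ᵐ ω ∂P,
      (∃ Z : ℝ → PAM.Site d,
        PAM.IsMaximizerPath (fun z => ξ z ω) Z ∧ PAM.IsRightContinuous Z) ∧
      ∀ Z : ℝ → PAM.Site d, PAM.IsMaximizerPath (fun z => ξ z ω) Z →
        (PAM.testIntegral d h < ∞ →
          limsup (fun t : ℝ => PAM.residualLifetime Z t / ENNReal.ofReal (t * h t)) atTop = 0) ∧
        (PAM.testIntegral d h = ∞ →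
          limsup (fun t : ℝ => PAM.residualLifetime Z t / ENNReal.ofReal (t * h t)) atTop = ∞) := by
  have hpath : ∀ᵐ ω ∂P, ∃ Z : ℝ → PAM.Site d,
      PAM.IsMaximizerPath (fun z => ξ z ω) Z ∧ PAM.IsRightContinuous Z := by
    filter_upwards [hξ.ae_one_lt, hξ.ae_finite_active hd hα] with ω hv hfin
    exact PAM.exists_rightContinuous_maximizerPath hv hfin
  rcases eq_or_ne (PAM.testIntegral d h) ∞ with hint | hint
  · filter_upwards [hpath, hξ.ae_limsup_eq_top hd hα hpos hmono hint] with ω h1 h2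
    exact ⟨h1, fun Z hZ => ⟨fun hlt => absurd hint hlt.ne, fun _ => h2 Z hZ⟩⟩
  · filter_upwards [hpath, hξ.ae_limsup_eq_zero hd hα hpos hmono (lt_top_iff_ne_top.2 hint)]
      with ω h1 h2
    exact ⟨h1, fun Z hZ => ⟨fun _ => h2 Z hZ, fun htop => absurd htop hint⟩⟩
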